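/- Let $$C(x)=\int_0^x\cos(\tfrac{\pi}{2}t^2)\,dt,\qquad S(x)=\int_0^x\sin(\tfrac{\pi}{2}t^2)\,dt\quad(x\in\mathbb R),\qquad F(z)=\frac{e^{-i\pi/4}}{\sqrt\pi}\int_z^{\infty}e^{it^2}\,dt\quad(z\in\mathbb C),$$ where $\int_z^\infty=\lim_{R\to+\infty}\int_z^R$ ($F$ is entire). For an integer $N\ge 1$ put $A_N=\sqrt{(N+1/2)\pi}$, $t_k=(k-\tfrac12)\pi/A_N$, and let $F_N$ be the meromorphic function $$F_N(z)=\frac12+\frac i2\tan\!\left(A_Nze^{i\pi/4}\right)+\frac{z}{A_N}e^{i(z^2+\pi/4)}\sum_{k=1}^N\frac{e^{-t_k^2}}{z^2+it_k^2}$$ (with its removable singularities $\pm e^{-i\pi/4}t_k$, $1\le k\le N$, removed). For real $x$ let $$C_N(x)=\frac12\,\frac{\sinh(\sqrt\pi A_Nx)+\sin(\sqrt\pi A_Nx)}{\cos(\sqrt\pi A_Nx)+\cosh(\sqrt\pi A_Nx)}+\frac{\sqrt\pi x}{A_N}\left(a_N(\tfrac\pi2x^2)\sin(\tfrac\pi2x^2)-b_N(\tfrac\pi2x^2)\cos(\tfrac\pi2x^2)\right),$$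 $$S_N(x)=\frac12\,\frac{\sinh(\sqrt\pi A_Nx)-\sin(\sqrt\pi A_Nx)}{\cos(\sqrt\pi A_Nx)+\cosh(\sqrt\pi A_Nx)}-\frac{\sqrt\pi x}{A_N}\left(a_N(\tfrac\pi2x^2)\cos(\tfrac\pi2x^2)+b_N(\tfrac\pi2x^2)\sin(\tfrac\pi2x^2)\right),$$ with $a_N(s)=s\sum_{k=1}^N\frac{e^{-t_k^2}}{s^2+t_k^4}$ and $b_N(s)=\sum_{k=1}^N\frac{t_k^2e^{-t_k^2}}{s^2+t_k^4}$. Finally let $\beta=1-\frac{\sqrt2}{2}-\frac{2\sqrt2+1}{16}$ and $$c_N=\frac{20\sqrt2\,e^{-\pi/2}}{9\pi(1-e^{-2A_N^2})}\left(1+2\sqrt\pi\,e^{-\beta A_N^2}\right)+\frac{(2\pi+1)e^{-\pi/2}}{2\sqrt2\,\pi^{3/2}A_N},\qquad \hat c_N=c_N+\frac{\sqrt2(2\pi+1)}{\pi^{3/2}e^{\pi/2}\sqrt{N+1/2}} .$$ Then for every $N\ge1$: 1. For every $z$ in the closed first or third quadrant, $\displaystyle |F(z)-F_N(z)|\le c_N\,\frac{e^{-\pi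 N}}{\sqrt{N+1/2}}$. 2. For every $z=x+iy$ in the closed second or fourth quadrant with $|y|\le A_N/(2\sqrt2)$, $\displaystyle |F(z)-F_N(z)|\le \hat c_N\,e^{-2xy}\,\frac{e^{-\pi N}}{\sqrt{N+1/2}}$. 3. For $|z|<A_N/\sqrt2$, $F(z)=\sum_{n\ge0}a_nz^n$ and $F_N(z)=\sum_{n\ge0}b_nz^n$, with $a_n=F^{(n)}(0)/n!$ and $b_n=F_N^{(n)}(0)/n!$. For real $|x|<A_N/\sqrt\pi$, the Maclaurin series of $C$ and $C_N$ converge to these functions and contain only powers $x^{4n+1}$, and those of $S$ and $S_N$ converge to these functions and contain only powers $x^{4n+3}$. 4. If $N\ge4$, then for $|z|<\sqrt{\pi/2}$ $$|F(z)-F_N(z)|\le\hat c_N\,\frac{e^{-\pi(N-1/4)}}{\sqrt{N+1/2}},\qquad\text{and}\qquad |a_n-b_n|\le\hat c_N\left(\frac2\pi\right)^{n/2}\frac{e^{-\pi(N-1/4)}}{\sqrt{N+1/2}}\quad(n\ge0),$$ and corresponding Maclaurin coefficients of $C$ and $C_N$, and of $S$ and $S_N$, differ in absolute value by at most $\displaystyle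 \sqrt2\,\hat c_N\,\frac{e^{-\pi(N-1/4)}}{\sqrt{N+1/2}}$. -/

import Mathlib

open Complex Filter Topology

noncomputable section

namespace FresnelTrap

/-- The integral of `exp (i t ^ 2)` along the straight segment from `z` to `w`. -/
def segInt (z w : ℂ) : ℂ :=
  (w - z) * ∫ s in (0 : ℝ)..1, cexp (I * (z + (s : ℂ) * (w - z)) ^ 2)

/-- The Fresnel integral `F(z) = (exp (-iπ/4) / √π) ∫_z^∞ exp (i t²) dt`, for complex `z`.
The integral is improper, the limit as `R → +∞` (`R` real) of the integrals from `z` to `R`. -/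
def fresnelF (z : ℂ) : ℂ :=
  cexp (-(I * (Real.pi / 4))) / (Real.sqrt Real.pi : ℂ) *
    limUnder atTop (fun R : ℝ => segInt z (R : ℂ))

/-- The Fresnel cosine integral. -/
def fresnelC (x : ℝ) : ℝ := ∫ t in (0 : ℝ)..x, Real.cos (Real.pi / 2 * t ^ 2)

/-- The Fresnel sine integral. -/
def fresnelS (x : ℝ) : ℝ := ∫ t in (0 : ℝ)..x, Real.sin (Real.pi / 2 * t ^ 2)

/-- `A_N = √((N + 1/2) π)`. -/
def A (N : ℕ) : ℝ := Real.sqrt (((N : ℝ) + 1 / 2) * Real.pi)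

/-- The quadrature points `t_k = (k - 1/2) π / √((N + 1/2) π)`. -/
def node (N k : ℕ) : ℝ := ((k : ℝ) - 1 / 2) * Real.pi / A N

/-- The formula for `F_N(z)`. As a meromorphic function of `z` it has removable singularities at
`z = ± exp (-iπ/4) t_k`, `1 ≤ k ≤ N`, where the formula itself has vanishing denominators. -/
def FNformula (N : ℕ) (z : ℂ) : ℂ :=
  1 / 2 + I / 2 * Complex.tan ((A N : ℂ) * z * cexp (I * (Real.pi / 4)))
    + z / (A N : ℂ) * cexp (I * (z ^ 2 + Real.pi / 4)) *
      ∑ k ∈ Finset.Icc 1 N, cexp (-(node N k : ℂ) ^ 2) / (z ^ 2 + I * (node N k : ℂ) ^ 2)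

/-- The approximation `F_N`, as a meromorphic function with its removable singularities removed:
the value at `z` is the limit at `z` of the formula (equal to the formula wherever the latter is
continuous). -/
def FN (N : ℕ) (z : ℂ) : ℂ := limUnder (𝓝[≠] z) (FNformula N)

/-- `a_N(s) = s ∑ exp (-t_k²) / (s² + t_k⁴)`. -/
def aN (N : ℕ) (s : ℝ) : ℝ :=
  s * ∑ k ∈ Finset.Icc 1 N, Real.exp (-(node N k) ^ 2) / (s ^ 2 + (node N k) ^ 4)

/-- `b_N(s) = ∑ t_k² exp (-t_k²) / (s² + t_k⁴)`. -/
def bN (N : ℕ) (s : ℝ) : ℝ :=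
  ∑ k ∈ Finset.Icc 1 N, (node N k) ^ 2 * Real.exp (-(node N k) ^ 2) / (s ^ 2 + (node N k) ^ 4)

/-- The approximation `C_N` to the Fresnel cosine integral. -/
def CN (N : ℕ) (x : ℝ) : ℝ :=
  1 / 2 * ((Real.sinh (Real.sqrt Real.pi * A N * x) + Real.sin (Real.sqrt Real.pi * A N * x)) /
      (Real.cos (Real.sqrt Real.pi * A N * x) + Real.cosh (Real.sqrt Real.pi * A N * x)))
    + Real.sqrt Real.pi * x / A N *
      (aN N (Real.pi / 2 * x ^ 2) * Real.sin (Real.pi / 2 * x ^ 2)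
        - bN N (Real.pi / 2 * x ^ 2) * Real.cos (Real.pi / 2 * x ^ 2))

/-- The approximation `S_N` to the Fresnel sine integral. -/
def SN (N : ℕ) (x : ℝ) : ℝ :=
  1 / 2 * ((Real.sinh (Real.sqrt Real.pi * A N * x) - Real.sin (Real.sqrt Real.pi * A N * x)) /
      (Real.cos (Real.sqrt Real.pi * A N * x) + Real.cosh (Real.sqrt Real.pi * A N * x)))
    - Real.sqrt Real.pi * x / A N *
      (aN N (Real.pi / 2 * x ^ 2) * Real.cos (Real.pi / 2 * x ^ 2)
        + bN N (Real.pi / 2 * x ^ 2) * Real.sin (Real.pi / 2 * x ^ 2))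

/-- `β = 1 - √2/2 - (2√2 + 1)/16`. -/
def beta : ℝ := 1 - Real.sqrt 2 / 2 - (2 * Real.sqrt 2 + 1) / 16

/-- The constant `c_N`. -/
def c (N : ℕ) : ℝ :=
  20 * Real.sqrt 2 * Real.exp (-(Real.pi / 2)) /
      (9 * Real.pi * (1 - Real.exp (-(2 * (A N) ^ 2)))) *
      (1 + 2 * Real.sqrt Real.pi * Real.exp (-(beta * (A N) ^ 2)))
    + (2 * Real.pi + 1) * Real.exp (-(Real.pi / 2)) /
      (2 * Real.sqrt 2 * Real.pi ^ (3 / 2 : ℝ) * A N)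

/-- The constant `ĉ_N`. -/
def cHat (N : ℕ) : ℝ :=
  c N + Real.sqrt 2 * (2 * Real.pi + 1) /
    (Real.pi ^ (3 / 2 : ℝ) * Real.exp (Real.pi / 2) * Real.sqrt ((N : ℝ) + 1 / 2))

/-- The `n`-th Maclaurin coefficient `f⁽ⁿ⁾(0) / n!`. -/
def macl {𝕜 : Type*} [NontriviallyNormedField 𝕜] (f : 𝕜 → 𝕜) (n : ℕ) : 𝕜 :=
  iteratedDeriv n f 0 / (n.factorial : 𝕜)

end FresnelTrap

end

namespace FresnelTrap

open MeasureTheory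

/-! Put `w = rot * z`, so that `w² = i z²`. The Gaussian limit and a substitution on the segment
from `0` to `z` give `F(z) = 1/2 + (i w / (2√π)) ∫₀¹ exp(s w²) s^(-1/2) ds`
(`fresnelF_eq_kernelInt`). The midpoint rule for `exp(-s t²)` has an exact error, by the theta
functional equation: `(2π/A) Σ_j exp(-s τ_j²) = √(π/s) (1 + 2 Σ_{n≥1} (-1)^n exp(-A² n²/s))`
(`tsum_exp_tau_eq`). Multiply by `exp(s w²)` and integrate over `0 < s < 1`. On the right, `n = 0`
produces `F` and the other terms are exponentially small. On the left, a node produces `(exp(w² -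
τ²) - 1)/(w² - τ²)`: the parts with `-1` sum to the tangent by partial fractions, the exponential
parts to the quadrature sum over all nodes. Hence `F - F_N` is `quadError` plus `truncError`, the
tail of the quadrature sum (`fresnelF_sub_FNformula`). No contour is shifted, and since both errors
are analytic in the regions concerned, the identity also removes the singularities of `F_N`
(`FN_eq_sub`).

The quadrature error is a series of integrals of `exp(s w²) exp(-a/s)/√s`. A direct estimate and an
integration by parts bound such an integral by multiples of `1/a` and of `1/|w|²`; their geometric
mean makes `|w|` times the integral bounded uniformly in `w` (`norm_quadError_le`). The tail is
geometric once `|w|/|t² - w²| ≤ K/t` holds for `t ≥ A`, and the regions differ only in `K` and in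
the bound for `Re w² = -2xy`.

For the series, `C + iS` and `C_N + iS_N` both have the form `(1 + i)(1/2 - Φ(√(π/2) x))`, with `Φ =
F` or `F_N`. As a function of `w`, `-i(Φ - 1/2)` is odd and real on the real axis, which leaves only
the exponents `4n+1` and `4n+3` (`scaledCoeff_structure`). Cauchy's estimate on the circle of radius
`√(π/2)` compares the coefficients. -/

/-- Differentiation under the integral sign for `∫ exp (k(s) w) ψ(s) ds`. -/
theorem hasDerivAt_integral_cexp_mul {k : ℝ → ℝ} (hk : Continuous k)
    (hk1 : ∀ s ∈ Set.Ioc (0 : ℝ) 1, |k s| ≤ 1) {ψ : ℝ → ℂ}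
    (hψ : IntervalIntegrable ψ volume 0 1) (w : ℂ) :
    HasDerivAt (fun w : ℂ => ∫ s in (0 : ℝ)..1, cexp (k s * w) * ψ s)
      (∫ s in (0 : ℝ)..1, k s * cexp (k s * w) * ψ s) w := by
  have hc (x : ℂ) : Continuous fun s : ℝ => cexp (k s * x) := by fun_prop
  have hc' (x : ℂ) : Continuous fun s : ℝ => k s * cexp (k s * x) := by fun_prop
  have hu : Set.uIoc (0 : ℝ) 1 = Set.Ioc 0 1 := Set.uIoc_of_le zero_le_one
  refine (intervalIntegral.hasDerivAt_integral_of_dominated_loc_of_deriv_le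
    (F := fun (w : ℂ) (s : ℝ) => cexp (k s * w) * ψ s)
    (F' := fun (w : ℂ) (s : ℝ) => k s * cexp (k s * w) * ψ s)
    (bound := fun s => Real.exp (‖w‖ + 1) * ‖ψ s‖)
    (Metric.ball_mem_nhds w one_pos) (Eventually.of_forall fun x => ?_) ?_ ?_ ?_ ?_ ?_).2
  · exact (intervalIntegrable_iff.1
      (hψ.continuousOn_mul (hc x).continuousOn)).aestronglyMeasurable
  · exact hψ.continuousOn_mul (hc w).continuousOn
  · exact (intervalIntegrable_iff.1
      (hψ.continuousOn_mul (hc' w).continuousOn)).aestronglyMeasurable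
  · refine Eventually.of_forall fun s hs x hx => ?_
    rw [hu] at hs
    have h1 := hk1 s hs
    have hx' : ‖x‖ ≤ ‖w‖ + 1 := by
      have := norm_sub_norm_le x w
      rw [Metric.mem_ball, dist_eq_norm] at hx
      linarith
    rw [norm_mul, norm_mul, Complex.norm_real, Real.norm_eq_abs]
    gcongr
    calc |k s| * ‖cexp (k s * x)‖ ≤ 1 * Real.exp (‖w‖ + 1) := by
          gcongr
          rw [Complex.norm_exp]
          apply Real.exp_le_exp.2
          calc ((k s : ℂ) * x).re ≤ ‖(k s : ℂ) * x‖ := Complex.re_le_norm _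
            _ = |k s| * ‖x‖ := by rw [norm_mul, Complex.norm_real, Real.norm_eq_abs]
            _ ≤ 1 * (‖w‖ + 1) := by gcongr
            _ = _ := one_mul _
      _ = _ := one_mul _
  · exact hψ.norm.const_mul _
  · refine Eventually.of_forall fun s _ x _ => ?_
    have := ((hasDerivAt_id x).const_mul (k s : ℂ)).cexp.mul_const (ψ s)
    exact this.congr_deriv (by simp only [id, mul_one]; ring)

/-! ### The primitive of `exp(i t²)` -/

theorem segInt_zero_eq (z : ℂ) :
    segInt 0 z = z * ∫ s in (0 : ℝ)..1, cexp (((s ^ 2 : ℝ) : ℂ) * (I * z ^ 2)) * 1 := by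
  unfold segInt
  rw [sub_zero]
  congr 1
  refine intervalIntegral.integral_congr fun s _ => ?_
  simp only [mul_one]
  congr 1
  push_cast
  ring

/-- The differentiated integrand is the total derivative of `s ↦ s exp(i s² z²)`, so the integral
collapses to its value at `s = 1`. -/
theorem hasDerivAt_segInt_zero (z : ℂ) : HasDerivAt (segInt 0) (cexp (I * z ^ 2)) z := by
  have hk : Continuous fun s : ℝ => s ^ 2 := by fun_prop
  have h1 := hasDerivAt_integral_cexp_mul hk
    (fun s hs => by rw [abs_of_nonneg (sq_nonneg s)]; nlinarith [hs.1, hs.2])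
    (ψ := fun _ => 1) intervalIntegrable_const (I * z ^ 2)
  have h2 : HasDerivAt (fun z : ℂ => I * z ^ 2) (2 * I * z) z := by
    exact ((hasDerivAt_pow 2 z).const_mul I).congr_deriv (by push_cast; ring)
  have h3 := (hasDerivAt_id z).mul (h1.comp z h2)
  have h4 : segInt 0 = id * ((fun w : ℂ => ∫ s in (0 : ℝ)..1, cexp (((s ^ 2 : ℝ) : ℂ) * w) * 1) ∘
      fun z => I * z ^ 2) := by
    funext z
    exact segInt_zero_eq z
  rw [h4]
  refine h3.congr_deriv ?_
  have h5 : ∀ s ∈ Set.uIcc (0 : ℝ) 1, HasDerivAt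
      (fun s : ℝ => (s : ℂ) * cexp (((s ^ 2 : ℝ) : ℂ) * (I * z ^ 2)))
      (cexp (((s ^ 2 : ℝ) : ℂ) * (I * z ^ 2)) * 1
        + 2 * I * z ^ 2 * (((s ^ 2 : ℝ) : ℂ) * cexp (((s ^ 2 : ℝ) : ℂ) * (I * z ^ 2)) * 1)) s := by
    intro s _
    have e1 : HasDerivAt (fun s : ℝ => (s : ℂ)) 1 s := Complex.ofRealCLM.hasDerivAt
    have e2 : HasDerivAt (fun s : ℝ => ((s ^ 2 : ℝ) : ℂ) * (I * z ^ 2))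
        (2 * s * (I * z ^ 2)) s := by
      have := (e1.pow 2).mul_const (I * z ^ 2)
      refine (this.congr_deriv (by push_cast; ring)).congr_of_eventuallyEq
        (Eventually.of_forall fun s => by simp)
    exact (e1.mul e2.cexp).congr_deriv (by push_cast; ring)
  have h6 := intervalIntegral.integral_eq_sub_of_hasDerivAt h5
    (Continuous.intervalIntegrable (by fun_prop) _ _)
  rw [intervalIntegral.integral_add (Continuous.intervalIntegrable (by fun_prop) _ _)
    (Continuous.intervalIntegrable (by fun_prop) _ _),
    intervalIntegral.integral_const_mul] at h6
  simp only [one_pow, ofReal_one, one_mul, ofReal_zero, zero_mul, sub_zero] at h6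
  rw [← h6]
  simp only [id, Function.comp]
  ring

/-- The integrand has the global primitive `segInt 0`; this path independence takes the place of
Cauchy's theorem. -/
theorem segInt_eq_sub (z w : ℂ) : segInt z w = segInt 0 w - segInt 0 z := by
  have h : ∀ s ∈ Set.uIcc (0 : ℝ) 1, HasDerivAt (fun s : ℝ => segInt 0 (z + (s : ℂ) * (w - z)))
      ((w - z) * cexp (I * (z + (s : ℂ) * (w - z)) ^ 2)) s := by
    intro s _
    have e1 : HasDerivAt (fun s : ℝ => z + (s : ℂ) * (w - z)) (1 * (w - z)) s :=
      (Complex.ofRealCLM.hasDerivAt.mul_const (w - z)).const_add z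
    have e2 := (hasDerivAt_segInt_zero (z + (s : ℂ) * (w - z))).comp s e1
    exact e2.congr_deriv (by ring)
  have := intervalIntegral.integral_eq_sub_of_hasDerivAt h
    (Continuous.intervalIntegrable (by fun_prop) _ _)
  rw [intervalIntegral.integral_const_mul] at this
  unfold segInt at this ⊢
  rw [this]
  simp

theorem norm_segInt_le (R : ℝ) (hR : 0 < R) :
    ‖segInt (R : ℂ) (R + R * I)‖ ≤ 1 / (2 * R) := by
  unfold segInt
  rw [add_sub_cancel_left, norm_mul]
  have h1 : ‖∫ s in (0 : ℝ)..1, cexp (I * ((R : ℂ) + (s : ℂ) * (R * I)) ^ 2)‖ ≤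
      ∫ s in (0 : ℝ)..1, Real.exp (-(2 * R ^ 2) * s) := by
    refine intervalIntegral.norm_integral_le_of_norm_le zero_le_one
      (Eventually.of_forall fun s _ => ?_) (Continuous.intervalIntegrable (by fun_prop) _ _)
    rw [Complex.norm_exp]
    apply le_of_eq
    congr 1
    have : I * ((R : ℂ) + (s : ℂ) * (R * I)) ^ 2
        = ((-(2 * R ^ 2) * s : ℝ) : ℂ) + ((R ^ 2 - s ^ 2 * R ^ 2 : ℝ) : ℂ) * I := by
      push_cast
      linear_combination (2 * (R : ℂ) ^ 2 * s + (s : ℂ) ^ 2 * R ^ 2 * I) * I_sq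
    rw [this, Complex.add_re, Complex.re_ofReal_mul, Complex.I_re, mul_zero, add_zero,
      Complex.ofReal_re]
  have h2 : ∫ s in (0 : ℝ)..1, Real.exp (-(2 * R ^ 2) * s) ≤ 1 / (2 * R ^ 2) := by
    rw [intervalIntegral.integral_comp_mul_left (fun x => Real.exp x)
      (neg_ne_zero.2 (by positivity)),
      integral_exp]
    simp only [mul_one, mul_zero, Real.exp_zero, smul_eq_mul]
    rw [inv_neg, neg_mul, ← mul_neg, neg_sub, one_div]
    have := Real.exp_pos (-(2 * R ^ 2))
    have h3 : 0 < (2 * R ^ 2)⁻¹ := by positivity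
    nlinarith
  calc ‖(R : ℂ) * I‖ * _ ≤ R * (1 / (2 * R ^ 2)) := by
        rw [norm_mul, Complex.norm_real, Complex.norm_I, mul_one, Real.norm_of_nonneg hR.le]
        gcongr
        exact h1.trans h2
    _ = 1 / (2 * R) := by field_simp

/-! ### Rotation to the Gaussian and the limit at infinity -/

/-- The rotation by `π / 4`, which takes the variable of `F` to that of the Gaussian. -/
noncomputable def rot : ℂ := cexp (I * (Real.pi / 4))

theorem rot_eq : rot = (1 + I) / Real.sqrt 2 := by
  have h2 : ((Real.sqrt 2 : ℝ) : ℂ) ^ 2 = 2 := by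
    rw [← ofReal_pow, Real.sq_sqrt (by norm_num)]; simp
  have h0 : ((Real.sqrt 2 : ℝ) : ℂ) ≠ 0 := by
    rw [ofReal_ne_zero]; positivity
  have h : I * (Real.pi / 4) = ((Real.pi / 4 : ℝ) : ℂ) * I := by push_cast; ring
  rw [rot, h, Complex.exp_mul_I, ← ofReal_cos, ← ofReal_sin, Real.cos_pi_div_four,
    Real.sin_pi_div_four]
  push_cast
  field_simp
  rw [h2]

theorem rot_sq : rot ^ 2 = I := by
  rw [rot, ← Complex.exp_nat_mul]
  exact (congrArg cexp (by push_cast; ring)).trans Complex.exp_pi_div_two_mul_I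

theorem rot_ne_zero : rot ≠ 0 := Complex.exp_ne_zero _

theorem norm_rot : ‖rot‖ = 1 := by
  have : I * (Real.pi / 4) = ((Real.pi / 4 : ℝ) : ℂ) * I := by push_cast; ring
  rw [rot, this, Complex.norm_exp_ofReal_mul_I]

theorem exp_neg_eq_inv_rot : cexp (-(I * (Real.pi / 4))) = rot⁻¹ := Complex.exp_neg _

/-- Go from `0` to `R` through `R + iR`: on the diagonal the integrand becomes `exp(-2x²)`, and the
vertical side contributes at most `1/(2R)`. -/
theorem tendsto_segInt_zero :
    Tendsto (fun R : ℝ => segInt 0 (R : ℂ)) atTop (𝓝 (rot * (Real.sqrt Real.pi / 2 : ℝ))) := by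
  have h1 : Tendsto (fun R : ℝ => ∫ x in (0 : ℝ)..R, Real.exp (-2 * x ^ 2)) atTop
      (𝓝 (Real.sqrt (Real.pi / 2) / 2)) := by
    rw [← integral_gaussian_Ioi 2]
    exact intervalIntegral_tendsto_integral_Ioi 0
      (integrable_exp_neg_mul_sq (by norm_num)).integrableOn tendsto_id
  have h2 (R : ℝ) : segInt 0 (R + R * I) =
      (1 + I) * ((∫ x in (0 : ℝ)..R, Real.exp (-2 * x ^ 2) : ℝ) : ℂ) := by
    have e : ∫ x in (0 : ℝ)..R, Real.exp (-2 * x ^ 2)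
        = R * ∫ s in (0 : ℝ)..1, Real.exp (-2 * (R * s) ^ 2) := by
      rw [intervalIntegral.mul_integral_comp_mul_left (f := fun x => Real.exp (-2 * x ^ 2))]
      simp
    rw [e, ofReal_mul, ← intervalIntegral.integral_ofReal]
    unfold segInt
    rw [sub_zero]
    have : ∀ s : ℝ, cexp (I * (0 + (s : ℂ) * (R + R * I)) ^ 2)
        = ((Real.exp (-2 * (R * s) ^ 2) : ℝ) : ℂ) := by
      intro s
      push_cast
      congr 1
      linear_combination (2 * (R : ℂ) ^ 2 * s ^ 2 + (s : ℂ) ^ 2 * R ^ 2 * I) * I_sq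
    simp_rw [this]
    ring
  have h3 : Tendsto (fun R : ℝ => segInt (R : ℂ) (R + R * I)) atTop (𝓝 0) := by
    refine squeeze_zero_norm' (a := fun R : ℝ => 1 / (2 * R)) ?_ ?_
    · filter_upwards [eventually_gt_atTop 0] with R hR using norm_segInt_le R hR
    · have : Tendsto (fun R : ℝ => 2 * R) atTop atTop :=
        tendsto_id.const_mul_atTop (by norm_num)
      simp_rw [one_div]
      exact this.inv_tendsto_atTop
  have h4 : (fun R : ℝ => segInt 0 (R : ℂ)) = fun R : ℝ =>
      (1 + I) * ((∫ x in (0 : ℝ)..R, Real.exp (-2 * x ^ 2) : ℝ) : ℂ)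
        - segInt (R : ℂ) (R + R * I) := by
    funext R
    rw [segInt_eq_sub (R : ℂ), h2]
    ring
  have h5 : rot * ((Real.sqrt Real.pi / 2 : ℝ) : ℂ)
      = (1 + I) * ((Real.sqrt (Real.pi / 2) / 2 : ℝ) : ℂ) - 0 := by
    rw [rot_eq, Real.sqrt_div Real.pi_pos.le]
    push_cast
    ring
  rw [h4, h5]
  exact ((Complex.continuous_ofReal.tendsto _).comp h1 |>.const_mul _).sub h3

theorem fresnelF_eq (z : ℂ) :
    fresnelF z = 1 / 2 - rot⁻¹ / (Real.sqrt Real.pi : ℂ) * segInt 0 z := by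
  have h : Tendsto (fun R : ℝ => segInt z (R : ℂ)) atTop
      (𝓝 (rot * (Real.sqrt Real.pi / 2 : ℝ) - segInt 0 z)) := by
    have : (fun R : ℝ => segInt z (R : ℂ)) = fun R : ℝ => segInt 0 (R : ℂ) - segInt 0 z := by
      funext R
      exact segInt_eq_sub z R
    rw [this]
    exact tendsto_segInt_zero.sub_const _
  have h0 : (Real.sqrt Real.pi : ℂ) ≠ 0 := by
    rw [ofReal_ne_zero]
    exact (Real.sqrt_pos.2 Real.pi_pos).ne'
  have h1 := rot_ne_zero
  rw [fresnelF, h.limUnder_eq, exp_neg_eq_inv_rot]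
  push_cast
  field_simp

theorem differentiable_fresnelF : Differentiable ℂ fresnelF := by
  have : fresnelF = fun z => 1 / 2 - rot⁻¹ / (Real.sqrt Real.pi : ℂ) * segInt 0 z :=
    funext fresnelF_eq
  rw [this]
  exact fun z => ((hasDerivAt_segInt_zero z).differentiableAt.const_mul _).const_sub _

/-! ### Partial fractions of the tangent -/

/-- The partial fraction expansion of `tan`. -/
theorem hasSum_pi_mul_tan {x : ℂ} (hx : 2 * x ∈ integerComplement) :
    HasSum (fun j : ℕ => 2 * x / (((j : ℂ) + 1 / 2) ^ 2 - x ^ 2))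
      (Real.pi * Complex.tan (Real.pi * x)) := by
  have hx1 : x ∈ integerComplement := by
    rw [mem_integerComplement_iff] at hx ⊢
    rintro ⟨n, hn⟩
    exact hx ⟨2 * n, by rw [← hn]; push_cast; ring⟩
  have hx0 : x ≠ 0 := integerComplement.ne_zero hx1
  have h1 := (summable_cotTerm hx1).hasSum
  have h2 := ((summable_cotTerm hx).hasSum).mul_left 2
  unfold cotTerm at h1 h2
  rw [← cot_series_rep' hx1] at h1
  rw [← cot_series_rep' hx] at h2
  -- From `tan y = cot y - 2 cot 2y`: in the series of `2 cot` at the doubled argument, the odd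
  -- indices reproduce the series of `cot`, so the even indices carry the tangent.
  have hodd : (fun k : ℕ => 2 * (1 / (2 * x - (((2 * k + 1 : ℕ) : ℂ) + 1))
      + 1 / (2 * x + (((2 * k + 1 : ℕ) : ℂ) + 1))))
      = fun k : ℕ => 1 / (x - ((k : ℂ) + 1)) + 1 / (x + ((k : ℂ) + 1)) := by
    funext k
    have e1 : 2 * x - (((2 * k + 1 : ℕ) : ℂ) + 1) = 2 * (x - ((k : ℂ) + 1)) := by
      push_cast; ring
    have e2 : 2 * x + (((2 * k + 1 : ℕ) : ℂ) + 1) = 2 * (x + ((k : ℂ) + 1)) := by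
      push_cast; ring
    rw [e1, e2]
    simp only [one_div, mul_inv]
    ring
  have heven (k : ℕ) : 2 * (1 / (2 * x - (((2 * k : ℕ) : ℂ) + 1))
      + 1 / (2 * x + (((2 * k : ℕ) : ℂ) + 1)))
      = -(2 * x / (((k : ℂ) + 1 / 2) ^ 2 - x ^ 2)) := by
    have n1 : 2 * x - (((2 * k : ℕ) : ℂ) + 1) ≠ 0 := fun h => by
      refine (mem_integerComplement_iff.1 hx) ⟨(2 * k + 1 : ℕ), ?_⟩
      rw [sub_eq_zero] at h
      rw [h]
      push_cast
      ring
    have n2 : 2 * x + (((2 * k : ℕ) : ℂ) + 1) ≠ 0 := fun h => by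
      refine (mem_integerComplement_iff.1 hx) ⟨-(2 * k + 1 : ℕ), ?_⟩
      rw [add_eq_zero_iff_eq_neg] at h
      rw [h]
      push_cast
      ring
    have e : (2 * x - (((2 * k : ℕ) : ℂ) + 1)) * (2 * x + (((2 * k : ℕ) : ℂ) + 1))
        = -4 * (((k : ℂ) + 1 / 2) ^ 2 - x ^ 2) := by push_cast; ring
    have n3 : ((k : ℂ) + 1 / 2) ^ 2 - x ^ 2 ≠ 0 := fun h => by
      rw [h, mul_zero] at e
      exact mul_ne_zero n1 n2 e
    rw [div_add_div _ _ n1 n2, e]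
    field_simp
    ring
  have hs := (summable_cotTerm hx).mul_left 2
  unfold cotTerm at hs
  have hse : Summable fun k : ℕ => 2 * (1 / (2 * x - (((2 * k : ℕ) : ℂ) + 1))
      + 1 / (2 * x + (((2 * k : ℕ) : ℂ) + 1))) :=
    hs.comp_injective (i := fun k : ℕ => 2 * k) (fun a b h => by simpa using h)
  have h3 := HasSum.even_add_odd (f := fun n : ℕ => 2 * (1 / (2 * x - ((n : ℂ) + 1))
      + 1 / (2 * x + ((n : ℂ) + 1)))) hse.hasSum (hodd ▸ h1)
  have h4 := h3.unique h2
  have h5 := hse.hasSum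
  rw [eq_sub_of_add_eq h4] at h5
  simp_rw [heven] at h5
  have h6 := h5.neg
  simp only [neg_neg] at h6
  refine (congrArg (HasSum _) ?_).mpr h6
  have s1 : Complex.sin (Real.pi * x) ≠ 0 := sin_pi_mul_ne_zero hx1
  have s2 : Complex.sin (Real.pi * (2 * x)) ≠ 0 := sin_pi_mul_ne_zero hx
  have e : (Real.pi : ℂ) * (2 * x) = 2 * (Real.pi * x) := by ring
  rw [e, Complex.sin_two_mul] at s2
  have s3 : Complex.cos (Real.pi * x) ≠ 0 := right_ne_zero_of_mul s2
  rw [e, Complex.cot_eq_cos_div_sin, Complex.cot_eq_cos_div_sin, Complex.tan_eq_sin_div_cos,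
    Complex.sin_two_mul, Complex.cos_two_mul']
  field_simp
  ring

/-! ### Quadrature nodes and the theta identity -/

/-- The positive quadrature points, numbered from `0`. -/
noncomputable def tau (N j : ℕ) : ℝ := ((j : ℝ) + 1 / 2) * Real.pi / A N

theorem node_succ (N j : ℕ) : node N (j + 1) = tau N j := by
  unfold node tau
  push_cast
  ring

theorem A_pos (N : ℕ) : 0 < A N := by
  unfold A
  have := Real.pi_pos
  positivity

theorem A_sq (N : ℕ) : A N ^ 2 = ((N : ℝ) + 1 / 2) * Real.pi := by
  have := Real.pi_pos
  exact Real.sq_sqrt (by positivity)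

theorem tau_pos (N j : ℕ) : 0 < tau N j := by
  have := A_pos N
  have := Real.pi_pos
  unfold tau
  positivity

/-- The choice `A² = (N + 1/2)π` puts the first omitted node, `j = 0`, exactly at `A`. -/
theorem tau_add (N j : ℕ) : tau N (N + j) = A N + j * (Real.pi / A N) := by
  have h := (A_pos N).ne'
  unfold tau
  push_cast
  field_simp
  rw [A_sq]
  ring

theorem summable_exp_neg_mul_nat_sq {c : ℝ} (hc : 0 < c) :
    Summable fun n : ℕ => Real.exp (-(c * (n : ℝ) ^ 2)) := by
  refine Summable.of_nonneg_of_le (fun _ => (Real.exp_pos _).le) (fun n => ?_)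
    (Real.summable_exp_nat_mul_of_ge (neg_lt_zero.2 hc) (f := fun n => (n : ℝ) ^ 2) fun n => ?_)
  · rw [neg_mul]
  · exact_mod_cast Nat.le_self_pow two_ne_zero n

theorem summable_exp_neg_mul_tau_sq (N : ℕ) {s : ℝ} (hs : 0 < s) :
    Summable fun j : ℕ => Real.exp (-(s * tau N j ^ 2)) := by
  have hA := A_pos N
  have hpi := Real.pi_pos
  refine Summable.of_nonneg_of_le (fun _ => (Real.exp_pos _).le) (fun j => ?_)
    (summable_exp_neg_mul_nat_sq (c := s * (Real.pi / A N) ^ 2) (by positivity))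
  apply Real.exp_le_exp.2
  rw [neg_le_neg_iff, mul_assoc, ← mul_pow]
  gcongr
  unfold tau
  rw [mul_div_assoc, mul_comm]
  gcongr
  linarith

/-- The coefficients of the theta series, as a series over the natural numbers. -/
def thetaCoeff (n : ℕ) : ℝ := if n = 0 then 1 else 2 * (-1) ^ n

theorem abs_thetaCoeff_le (n : ℕ) : |thetaCoeff n| ≤ 2 := by
  unfold thetaCoeff
  split_ifs <;> simp [abs_mul]

theorem tsum_int_alternating {f : ℝ → ℝ} (hf : ∀ x, f (-x) = f x)
    (hs : Summable fun n : ℕ => f n) :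
    ∑' n : ℤ, (-1) ^ n * f n = ∑' n : ℕ, thetaCoeff n * f n := by
  have sL' : Summable fun n : ℕ => (-1) ^ n * f n := by
    refine Summable.of_norm (hs.norm.congr fun n => ?_)
    rw [norm_mul, norm_pow, norm_neg, norm_one, one_pow, one_mul]
  have hneg : (fun n : ℕ => (-1 : ℝ) ^ (-((n : ℤ) + 1)) * f ((-((n : ℤ) + 1) : ℤ) : ℝ))
      = fun n : ℕ => (-1) ^ (n + 1) * f ((n + 1 : ℕ) : ℝ) := by
    funext n
    congr 1
    · rw [zpow_neg, ← inv_zpow, inv_neg, inv_one]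
      norm_cast
    · rw [← hf]
      congr 1
      push_cast
      ring
  have hpos : (fun n : ℕ => (-1 : ℝ) ^ (n : ℤ) * f ((n : ℤ) : ℝ))
      = fun n : ℕ => (-1) ^ n * f n := by
    funext n
    rw [zpow_natCast, Int.cast_natCast]
  have s1 := (summable_nat_add_iff 1).2 sL'
  have hth (n : ℕ) : thetaCoeff (n + 1) * f ((n + 1 : ℕ) : ℝ) =
      2 * ((-1) ^ (n + 1) * f ((n + 1 : ℕ) : ℝ)) := by
    rw [thetaCoeff, if_neg (Nat.succ_ne_zero n), mul_assoc]
  have s2 : Summable fun n : ℕ => thetaCoeff (n + 1) * f ((n + 1 : ℕ) : ℝ) :=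
    (s1.mul_left 2).congr fun n => (hth n).symm
  have e := tsum_of_nat_of_neg_add_one (f := fun n : ℤ => (-1) ^ n * f n)
    (by rw [hpos]; exact sL') (by rw [hneg]; exact s1)
  have e0 : thetaCoeff 0 = 1 := by rw [thetaCoeff, if_pos rfl]
  have e1 := tsum_eq_zero_add' (f := fun n : ℕ => (-1) ^ n * f n) s1
  have e2 := tsum_eq_zero_add' (f := fun n : ℕ => thetaCoeff n * f n) s2
  rw [e, hneg, hpos, e1, e2]
  simp_rw [hth]
  rw [tsum_mul_left, e0, pow_zero]
  ring

/-- The functional equation of the theta function that underlies the midpoint rule for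
`exp (-s t²)`. -/
theorem tsum_exp_tau_eq (N : ℕ) {s : ℝ} (hs : 0 < s) :
    2 * (Real.pi / A N) * ∑' j : ℕ, Real.exp (-(s * tau N j ^ 2)) =
      Real.sqrt Real.pi / Real.sqrt s *
        ∑' n : ℕ, thetaCoeff n * Real.exp (-(A N ^ 2 * (n : ℝ) ^ 2 / s)) := by
  have hA := A_pos N
  have hpi := Real.pi_pos
  set a : ℝ := A N ^ 2 / (Real.pi * s) with ha
  have ha0 : 0 < a := by positivity
  -- The shift `-i/2` turns the linear exponential into `(-1)^n` on one side and moves the nodes to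
  -- half-integers on the other.
  have key := Complex.tsum_exp_neg_quadratic (a := (a : ℂ)) (by simpa using ha0) (-I / 2)
  have hL (n : ℤ) : cexp (-Real.pi * a * (n : ℂ) ^ 2 + 2 * Real.pi * (-I / 2) * n) =
      (((-1) ^ n * Real.exp (-(A N ^ 2 * (n : ℝ) ^ 2 / s)) : ℝ) : ℂ) := by
    rw [Complex.exp_add, mul_comm]
    push_cast
    congr 1
    · have : 2 * (Real.pi : ℂ) * (-I / 2) * n = n * (-(Real.pi * I)) := by ring
      rw [this, Complex.exp_int_mul, Complex.exp_neg, Complex.exp_pi_mul_I]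
      norm_num
    · congr 1
      rw [ha]
      push_cast
      have : (Real.pi : ℂ) ≠ 0 := by exact_mod_cast hpi.ne'
      have : (s : ℂ) ≠ 0 := by exact_mod_cast hs.ne'
      field_simp
  have hR (n : ℤ) : cexp (-Real.pi / a * ((n : ℂ) + I * (-I / 2)) ^ 2) =
      ((Real.exp (-(s * (((n : ℝ) + 1 / 2) * Real.pi / A N) ^ 2)) : ℝ) : ℂ) := by
    have e : (n : ℂ) + I * (-I / 2) = n + 1 / 2 := by
      linear_combination (-1 / 2 : ℂ) * I_sq
    rw [e, ha]
    push_cast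
    congr 1
    have : (Real.pi : ℂ) ≠ 0 := by exact_mod_cast hpi.ne'
    have : (s : ℂ) ≠ 0 := by exact_mod_cast hs.ne'
    have : (A N : ℂ) ≠ 0 := by exact_mod_cast hA.ne'
    field_simp
  simp_rw [hL, hR] at key
  have hsq : (1 : ℂ) / (a : ℂ) ^ (1 / 2 : ℂ) = ((1 / Real.sqrt a : ℝ) : ℂ) := by
    rw [Real.sqrt_eq_rpow]
    push_cast [ofReal_cpow ha0.le]
    rfl
  rw [hsq, ← ofReal_tsum, ← ofReal_tsum, ← ofReal_mul, ofReal_inj] at key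
  have sR : Summable fun j : ℕ => Real.exp (-(s * tau N j ^ 2)) := summable_exp_neg_mul_tau_sq N hs
  have sL : Summable fun n : ℕ => Real.exp (-(A N ^ 2 * (n : ℝ) ^ 2 / s)) := by
    have := summable_exp_neg_mul_nat_sq (c := A N ^ 2 / s) (by positivity)
    refine this.congr fun n => ?_
    congr 2
    ring
  have tR : ∑' n : ℤ, Real.exp (-(s * (((n : ℝ) + 1 / 2) * Real.pi / A N) ^ 2)) =
      2 * ∑' j : ℕ, Real.exp (-(s * tau N j ^ 2)) := by
    have hneg : (fun n : ℕ => Real.exp (-(s * ((((-((n : ℤ) + 1) : ℤ) : ℝ) + 1 / 2)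
        * Real.pi / A N) ^ 2))) = fun j : ℕ => Real.exp (-(s * tau N j ^ 2)) := by
      funext n
      unfold tau
      congr 1
      push_cast
      ring
    have hpos : (fun n : ℕ => Real.exp (-(s * ((((n : ℤ) : ℝ) + 1 / 2)
        * Real.pi / A N) ^ 2))) = fun j : ℕ => Real.exp (-(s * tau N j ^ 2)) := by
      funext n
      simp [tau]
    rw [tsum_of_nat_of_neg_add_one, hneg, hpos, two_mul]
    · rw [hpos]; exact sR
    · rw [hneg]; exact sR
  have tL : ∑' n : ℤ, (-1) ^ n * Real.exp (-(A N ^ 2 * (n : ℝ) ^ 2 / s)) =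
      ∑' n : ℕ, thetaCoeff n * Real.exp (-(A N ^ 2 * (n : ℝ) ^ 2 / s)) := by
    exact tsum_int_alternating (f := fun x => Real.exp (-(A N ^ 2 * x ^ 2 / s)))
      (fun x => by simp only [neg_sq]) sL
  rw [tR, tL] at key
  rw [key, ha, Real.sqrt_div (by positivity), Real.sqrt_sq hA.le, Real.sqrt_mul hpi.le]
  have h1 : Real.sqrt Real.pi ≠ 0 := by positivity
  have h2 : Real.sqrt s ≠ 0 := by positivity
  field_simp
  rw [Real.sq_sqrt hpi.le]
  ring

/-! ### Estimates for the kernel integrals -/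

/-- The kernel `exp (-a / s) / √s`. -/
noncomputable def gaussKernel (a s : ℝ) : ℝ := Real.exp (-(a / s)) / Real.sqrt s

/-- The exponential transform of `gaussKernel a` over the unit interval. -/
noncomputable def kernelInt (a : ℝ) (u : ℂ) : ℂ :=
  ∫ s in (0 : ℝ)..1, cexp (s * u) * (gaussKernel a s : ℂ)

theorem gaussKernel_nonneg (a s : ℝ) : 0 ≤ gaussKernel a s := by
  unfold gaussKernel
  positivity

theorem norm_gaussKernel (a s : ℝ) : ‖(gaussKernel a s : ℂ)‖ = gaussKernel a s := by
  rw [Complex.norm_real, Real.norm_of_nonneg (gaussKernel_nonneg a s)]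

theorem intervalIntegrable_gaussKernel {a : ℝ} (ha : 0 ≤ a) :
    IntervalIntegrable (gaussKernel a) volume 0 1 := by
  refine (intervalIntegral.intervalIntegrable_rpow' (a := 0) (b := 1) (r := -(1 / 2))
    (by norm_num)).mono_fun' ?_ ?_
  · refine Measurable.aestronglyMeasurable ?_
    unfold gaussKernel
    fun_prop
  · refine (ae_restrict_mem measurableSet_uIoc).mono fun s hs => ?_
    rw [Set.uIoc_of_le zero_le_one] at hs
    have hs0 := hs.1
    simp only [Real.norm_of_nonneg (gaussKernel_nonneg a s)]
    unfold gaussKernel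
    rw [Real.rpow_neg hs0.le, ← Real.sqrt_eq_rpow, div_eq_mul_inv]
    refine mul_le_of_le_one_left (by positivity) (Real.exp_le_one_iff.2 ?_)
    rw [neg_nonpos]
    positivity

theorem intervalIntegrable_ofReal_gaussKernel {a : ℝ} (ha : 0 ≤ a) :
    IntervalIntegrable (fun s => (gaussKernel a s : ℂ)) volume 0 1 :=
  ⟨(intervalIntegrable_gaussKernel ha).1.ofReal, (intervalIntegrable_gaussKernel ha).2.ofReal⟩

theorem differentiable_kernelInt {a : ℝ} (ha : 0 ≤ a) : Differentiable ℂ (kernelInt a) := fun u =>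
  (hasDerivAt_integral_cexp_mul (k := id) continuous_id
    (fun s hs => abs_le.2 ⟨by linarith [hs.1, show id s = s from rfl], hs.2⟩)
    (intervalIntegrable_ofReal_gaussKernel ha) u).differentiableAt

theorem norm_cexp_mul_le {u : ℂ} {ρ : ℝ} (h0 : 0 ≤ ρ) (hu : u.re ≤ ρ) {s : ℝ} (hs0 : 0 ≤ s)
    (hs1 : s ≤ 1) : ‖cexp (s * u)‖ ≤ Real.exp ρ := by
  rw [Complex.norm_exp, Complex.re_ofReal_mul]
  exact Real.exp_le_exp.2 (by nlinarith)

theorem hasDerivAt_exp_neg_div (a : ℝ) {s : ℝ} (hs : s ≠ 0) :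
    HasDerivAt (fun s : ℝ => Real.exp (-(a / s))) (a / s ^ 2 * Real.exp (-(a / s))) s := by
  have h := ((hasDerivAt_inv hs).const_mul a).neg.exp
  refine (h.congr_deriv ?_).congr_of_eventuallyEq (Eventually.of_forall fun x => ?_)
  · simp only [Pi.neg_apply, div_eq_mul_inv]
    ring
  · simp only [div_eq_mul_inv]
    rfl

/-- On `(0,1)` one has `1/√s ≤ 1/s ≤ 1/a + 1/s`, and `(1/a + 1/s) exp(-a/s)` is the derivative of `s
exp(-a/s)/a`. -/
theorem integral_gaussKernel_le {a : ℝ} (ha : 0 < a) :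
    ∫ s in (0 : ℝ)..1, gaussKernel a s ≤ Real.exp (-a) / a := by
  have hc : ContinuousOn (fun s : ℝ => s * Real.exp (-(a / s))) (Set.Icc 0 1) := by
    intro s hs
    rcases hs.1.eq_or_lt with h | h
    · subst h
      have h1 : Tendsto (fun s : ℝ => s) (𝓝[Set.Icc 0 1] 0) (𝓝 0) :=
        tendsto_id.mono_left nhdsWithin_le_nhds
      have : Tendsto (fun s : ℝ => s * Real.exp (-(a / s))) (𝓝[Set.Icc 0 1] 0) (𝓝 0) := by
        refine squeeze_zero' ?_ ?_ h1
        · filter_upwards [self_mem_nhdsWithin] with s hs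
          exact mul_nonneg hs.1 (Real.exp_pos _).le
        · filter_upwards [self_mem_nhdsWithin] with s hs
          refine mul_le_of_le_one_right hs.1 (Real.exp_le_one_iff.2 ?_)
          rw [neg_nonpos]
          exact div_nonneg ha.le hs.1
      unfold ContinuousWithinAt
      simpa using this
    · exact (continuousAt_id.mul
        (hasDerivAt_exp_neg_div a h.ne').continuousAt).continuousWithinAt
  have hd : ∀ s ∈ Set.Ioo (0 : ℝ) 1, HasDerivAt (fun s : ℝ => s * Real.exp (-(a / s)))
      ((1 + a / s) * Real.exp (-(a / s))) s := by
    intro s hs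
    have hs0 := hs.1.ne'
    refine ((hasDerivAt_id s).mul (hasDerivAt_exp_neg_div a hs0)).congr_deriv ?_
    simp only [id]
    field_simp
  have hi : IntervalIntegrable (fun s : ℝ => (1 + a / s) * Real.exp (-(a / s))) volume 0 1 := by
    refine intervalIntegral.intervalIntegrable_deriv_of_nonneg (by rwa [Set.uIcc_of_le zero_le_one])
      (by simpa using hd) (fun s hs => ?_)
    have hs0 : 0 < s := by simpa using hs.1
    positivity
  have hI := intervalIntegral.integral_eq_sub_of_hasDerivAt_of_le zero_le_one hc hd hi
  calc ∫ s in (0 : ℝ)..1, gaussKernel a s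
      ≤ ∫ s in (0 : ℝ)..1, a⁻¹ * ((1 + a / s) * Real.exp (-(a / s))) := by
        refine intervalIntegral.integral_mono_on_of_le_Ioo zero_le_one
          (intervalIntegrable_gaussKernel ha.le) (hi.const_mul _) (fun s hs => ?_)
        have hs0 := hs.1
        have hsq : s ≤ Real.sqrt s := Real.le_sqrt_of_sq_le (by nlinarith [hs.2])
        have h1 : 1 / Real.sqrt s ≤ 1 / s := one_div_le_one_div_of_le hs0 hsq
        have h2 : a⁻¹ * ((1 + a / s) * Real.exp (-(a / s)))
            = (a⁻¹ + 1 / s) * Real.exp (-(a / s)) := by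
          field_simp
        rw [h2, gaussKernel, div_eq_mul_one_div, mul_comm]
        gcongr
        have : 0 < a⁻¹ := by positivity
        linarith
    _ = Real.exp (-a) / a := by
        rw [intervalIntegral.integral_const_mul, hI]
        simp
        ring

theorem norm_kernelInt_le {a : ℝ} (ha : 0 < a) {u : ℂ} {ρ : ℝ} (h0 : 0 ≤ ρ) (hu : u.re ≤ ρ) :
    ‖kernelInt a u‖ ≤ Real.exp ρ * (Real.exp (-a) / a) := by
  refine (intervalIntegral.norm_integral_le_of_norm_le zero_le_one
    (g := fun s => Real.exp ρ * gaussKernel a s) (Eventually.of_forall fun s hs => ?_)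
    ((intervalIntegrable_gaussKernel ha.le).const_mul _)).trans ?_
  · rw [norm_mul, norm_gaussKernel]
    gcongr
    · exact gaussKernel_nonneg a s
    · exact norm_cexp_mul_le h0 hu hs.1.le hs.2
  · rw [intervalIntegral.integral_const_mul]
    gcongr
    exact integral_gaussKernel_le ha

theorem continuousOn_gaussKernel {a : ℝ} (ha : 0 < a) :
    ContinuousOn (gaussKernel a) (Set.Icc 0 1) := by
  intro s hs
  rcases hs.1.eq_or_lt with h | h
  · subst h
    have h1 : Tendsto (fun s : ℝ => Real.sqrt s / a) (𝓝[Set.Icc 0 1] 0) (𝓝 0) := by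
      have : Tendsto (fun s : ℝ => Real.sqrt s / a) (𝓝 0) (𝓝 (Real.sqrt 0 / a)) :=
        (Real.continuous_sqrt.div_const a).tendsto 0
      rw [Real.sqrt_zero, zero_div] at this
      exact this.mono_left nhdsWithin_le_nhds
    have h2 : gaussKernel a 0 = 0 := by simp [gaussKernel]
    unfold ContinuousWithinAt
    rw [h2]
    refine squeeze_zero' (Eventually.of_forall fun s => gaussKernel_nonneg a s) ?_ h1
    filter_upwards [self_mem_nhdsWithin] with s hs
    rcases hs.1.eq_or_lt with h | h
    · rw [← h, h2, Real.sqrt_zero, zero_div]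
    · unfold gaussKernel
      rw [div_le_div_iff₀ (Real.sqrt_pos.2 h) ha, Real.mul_self_sqrt h.le, Real.exp_neg]
      have h3 : a / s ≤ Real.exp (a / s) := by linarith [Real.add_one_le_exp (a / s)]
      rw [inv_mul_le_iff₀ (Real.exp_pos _)]
      rwa [div_le_iff₀ h] at h3
  · exact ((hasDerivAt_exp_neg_div a h.ne').continuousAt.div
      Real.continuous_sqrt.continuousAt (Real.sqrt_pos.2 h).ne').continuousWithinAt

theorem hasDerivAt_gaussKernel (a : ℝ) {s : ℝ} (hs : 0 < s) :
    HasDerivAt (gaussKernel a) (gaussKernel a s * (a / s ^ 2 - 1 / (2 * s))) s := by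
  have h1 := (hasDerivAt_exp_neg_div a hs.ne').div (Real.hasDerivAt_sqrt hs.ne')
    (Real.sqrt_pos.2 hs).ne'
  refine h1.congr_deriv ?_
  have h2 : Real.sqrt s ≠ 0 := (Real.sqrt_pos.2 hs).ne'
  have h3 : Real.sqrt s ^ 2 = s := Real.sq_sqrt hs.le
  unfold gaussKernel
  field_simp
  rw [h3]
  ring

/-- Integration by parts moves the factor `u` onto the kernel. For `a ≥ 1/2` the kernel increases on
`[0,1]` from `0` to `exp(-a)`, so the boundary term and the total variation each cost `exp(-a)`;
hence the `2`. -/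
theorem norm_mul_kernelInt_le {a : ℝ} (ha : 1 / 2 ≤ a) {u : ℂ} {ρ : ℝ} (h0 : 0 ≤ ρ)
    (hu : u.re ≤ ρ) : ‖u * kernelInt a u‖ ≤ 2 * Real.exp ρ * Real.exp (-a) := by
  have ha0 : 0 < a := by linarith
  set φ' : ℝ → ℝ := fun s => gaussKernel a s * (a / s ^ 2 - 1 / (2 * s)) with hφ'
  have hd : ∀ s ∈ Set.Ioo (0 : ℝ) 1, HasDerivAt (gaussKernel a) (φ' s) s := fun s hs =>
    hasDerivAt_gaussKernel a hs.1
  have hpos : ∀ s ∈ Set.Ioo (0 : ℝ) 1, 0 ≤ φ' s := fun s hs => by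
    refine mul_nonneg (gaussKernel_nonneg a s) ?_
    have hs0 := hs.1
    rw [sub_nonneg, div_le_div_iff₀ (by positivity) (by positivity)]
    nlinarith [hs.2]
  have hi : IntervalIntegrable φ' volume 0 1 :=
    intervalIntegral.intervalIntegrable_deriv_of_nonneg
      (by rw [Set.uIcc_of_le zero_le_one]; exact continuousOn_gaussKernel ha0)
      (by simpa using hd) (by simpa using hpos)
  have hI := intervalIntegral.integral_eq_sub_of_hasDerivAt_of_le zero_le_one
    (continuousOn_gaussKernel ha0) hd hi
  have g0 : gaussKernel a 0 = 0 := by simp [gaussKernel]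
  have g1 : gaussKernel a 1 = Real.exp (-a) := by simp [gaussKernel]
  have hparts := intervalIntegral.integral_mul_deriv_eq_deriv_mul_of_hasDerivAt (a := 0) (b := 1)
    (u := fun s => (gaussKernel a s : ℂ)) (u' := fun s => (φ' s : ℂ))
    (v := fun s : ℝ => cexp (s * u)) (v' := fun s : ℝ => cexp (s * u) * u)
    (by
      rw [Set.uIcc_of_le zero_le_one]
      exact Complex.continuous_ofReal.comp_continuousOn (continuousOn_gaussKernel ha0))
    (by fun_prop)
    (fun s hs => (hd s (by simpa using hs)).ofReal_comp)
    (fun s _ => by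
      have := (Complex.ofRealCLM.hasDerivAt (x := s)).mul_const u
      simpa using this.cexp)
    ⟨hi.1.ofReal, hi.2.ofReal⟩ (Continuous.intervalIntegrable (by fun_prop) _ _)
  have hK : u * kernelInt a u
      = ∫ s in (0 : ℝ)..1, (gaussKernel a s : ℂ) * (cexp (s * u) * u) := by
    unfold kernelInt
    rw [← intervalIntegral.integral_const_mul]
    congr 1
    funext s
    ring
  rw [hK, hparts, g0, g1]
  have hint : ‖∫ s in (0 : ℝ)..1, (φ' s : ℂ) * cexp (s * u)‖ ≤ Real.exp ρ * Real.exp (-a) := by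
    have : ∫ s in (0 : ℝ)..1, Real.exp ρ * φ' s = Real.exp ρ * Real.exp (-a) := by
      rw [intervalIntegral.integral_const_mul, hI, g0, g1, sub_zero]
    rw [← this]
    refine intervalIntegral.norm_integral_le_of_norm_le zero_le_one ?_ (hi.const_mul _)
    have h1 : ∀ᵐ s : ℝ, s ≠ 1 := by simp [ae_iff]
    filter_upwards [h1] with s hs1 hs
    have hp := hpos s ⟨hs.1, lt_of_le_of_ne hs.2 hs1⟩
    rw [norm_mul, Complex.norm_real, Real.norm_of_nonneg hp, mul_comm]
    gcongr
    exact norm_cexp_mul_le h0 hu hs.1.le hs.2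
  have hend : ‖((Real.exp (-a) : ℝ) : ℂ) * cexp (((1 : ℝ) : ℂ) * u)‖
      ≤ Real.exp ρ * Real.exp (-a) := by
    rw [norm_mul, Complex.norm_real, Real.norm_of_nonneg (Real.exp_pos _).le, mul_comm]
    gcongr
    exact norm_cexp_mul_le h0 hu zero_le_one le_rfl
  calc _ ≤ Real.exp ρ * Real.exp (-a) + Real.exp ρ * Real.exp (-a) := by
        refine (norm_sub_le _ _).trans (add_le_add ?_ hint)
        rw [ofReal_zero, zero_mul, sub_zero]
        exact hend
    _ = _ := by ring

/-- The substitution `r = √s` on the unit segment. This identifies `F` with the `n = 0` term of the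
integrated theta identity. -/
theorem fresnelF_eq_kernelInt (z : ℂ) :
    fresnelF z = 1 / 2 + I * (rot * z) / (2 * Real.sqrt Real.pi) * kernelInt 0 ((rot * z) ^ 2) := by
  have hs : (Real.sqrt Real.pi : ℂ) ≠ 0 := by
    rw [ofReal_ne_zero]
    exact (Real.sqrt_pos.2 Real.pi_pos).ne'
  have hu : (rot * z) ^ 2 = I * z ^ 2 := by rw [mul_pow, rot_sq]
  have hrot : rot⁻¹ = -I * rot := by
    refine inv_eq_of_mul_eq_one_right ?_
    linear_combination -I * rot_sq - I_sq
  have hsub := intervalIntegral.integral_deriv_smul_comp''' (a := 0) (b := 1) (f := Real.sqrt)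
    (f' := fun s => 1 / (2 * Real.sqrt s))
    (g := fun r : ℝ => cexp (((r ^ 2 : ℝ) : ℂ) * (I * z ^ 2)))
    Real.continuous_sqrt.continuousOn
    (fun s hs => by
      have hs0 : 0 < s := by simpa using hs.1
      exact (Real.hasDerivAt_sqrt hs0.ne').hasDerivWithinAt)
    (Continuous.continuousOn (by fun_prop))
    (ContinuousOn.integrableOn_compact (isCompact_uIcc.image Real.continuous_sqrt)
      (Continuous.continuousOn (by fun_prop)))
    (by
      rw [Set.uIcc_of_le zero_le_one, integrableOn_Icc_iff_integrableOn_Ioc]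
      have h := ((intervalIntegrable_ofReal_gaussKernel le_rfl).continuousOn_mul
        (g := fun s : ℝ => cexp (s * (I * z ^ 2)) / 2)
        (Continuous.continuousOn (by fun_prop))).1
      refine h.congr_fun (fun s hs => ?_) measurableSet_Ioc
      simp only [Function.comp, Real.sq_sqrt hs.1.le, gaussKernel, zero_div, neg_zero,
        Real.exp_zero, Complex.real_smul]
      push_cast
      field_simp)
  have hk : kernelInt 0 (I * z ^ 2)
      = 2 * ∫ s in (0 : ℝ)..1, cexp (((s ^ 2 : ℝ) : ℂ) * (I * z ^ 2)) * 1 := by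
    simp only [mul_one]
    rw [Real.sqrt_zero, Real.sqrt_one] at hsub
    rw [← hsub, ← intervalIntegral.integral_const_mul]
    refine intervalIntegral.integral_congr fun s hs => ?_
    rw [Set.uIcc_of_le zero_le_one] at hs
    simp only [Function.comp, Real.sq_sqrt hs.1, gaussKernel, zero_div, neg_zero, Real.exp_zero,
      Complex.real_smul]
    push_cast
    field_simp
  rw [fresnelF_eq, segInt_zero_eq, hu, hk, hrot]
  field_simp
  ring

/-! ### The theta identity integrated term by term -/

theorem summable_one_div_tau_sq (N : ℕ) : Summable fun j : ℕ => 1 / tau N j ^ 2 := by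
  have hA := A_pos N
  have hpi := Real.pi_pos
  have h := ((summable_nat_add_iff 1).2
    (Real.summable_one_div_nat_pow.2 one_lt_two)).mul_left ((2 * A N / Real.pi) ^ 2)
  refine Summable.of_nonneg_of_le (fun j => by positivity) (fun j => ?_) h
  have h1 : ((j : ℝ) + 1) * (Real.pi / (2 * A N)) ≤ tau N j := by
    have : tau N j = (2 * (j : ℝ) + 1) * (Real.pi / (2 * A N)) := by
      unfold tau
      field_simp
    rw [this]
    have hj : (0 : ℝ) ≤ j := j.cast_nonneg
    gcongr
    linarith
  calc 1 / tau N j ^ 2 ≤ 1 / (((j : ℝ) + 1) * (Real.pi / (2 * A N))) ^ 2 := by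
        gcongr
    _ = _ := by
        push_cast
        field_simp

theorem integral_exp_neg_mul_le {b : ℝ} (hb : 0 < b) :
    ∫ s in (0 : ℝ)..1, Real.exp (-(s * b)) ≤ 1 / b := by
  have h : ∀ s : ℝ, -(s * b) = -b * s := fun s => by ring
  simp_rw [h]
  rw [intervalIntegral.integral_comp_mul_left (fun x => Real.exp x) (neg_ne_zero.2 hb.ne'),
    integral_exp]
  simp only [mul_one, mul_zero, Real.exp_zero, smul_eq_mul]
  rw [inv_neg, neg_mul, ← mul_neg, neg_sub, one_div]
  have := Real.exp_pos (-b)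
  have h3 : 0 < b⁻¹ := by positivity
  nlinarith

/-- Integration of the functional equation of the theta function against `exp (s u)`. -/
theorem exists_hasSum_tau_and_hasSum_kernelInt (N : ℕ) (u : ℂ) : ∃ V : ℂ,
    HasSum (fun j : ℕ => ((2 * (Real.pi / A N) : ℝ) : ℂ) *
      ∫ s in (0 : ℝ)..1, cexp (s * (u - (tau N j : ℂ) ^ 2))) V ∧
    HasSum (fun n : ℕ => ((Real.sqrt Real.pi * thetaCoeff n : ℝ) : ℂ) *
      kernelInt (A N ^ 2 * (n : ℝ) ^ 2) u) V := by
  have hA := A_pos N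
  have hpi := Real.pi_pos
  set ρ : ℝ := max 0 u.re
  have h0 : 0 ≤ ρ := le_max_left _ _
  have hu : u.re ≤ ρ := le_max_right _ _
  set μ : Measure ℝ := volume.restrict (Set.Ioc 0 1) with hμ
  set c : ℝ := 2 * (Real.pi / A N) with hc
  have hc0 : 0 < c := by positivity
  set f : ℕ → ℝ → ℂ := fun j s => cexp (s * u) * ((c * Real.exp (-(s * tau N j ^ 2)) : ℝ) : ℂ)
    with hf
  set g : ℕ → ℝ → ℂ := fun n s => cexp (s * u) *
    ((Real.sqrt Real.pi * thetaCoeff n * gaussKernel (A N ^ 2 * (n : ℝ) ^ 2) s : ℝ) : ℂ) with hg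
  have ha (n : ℕ) : 0 ≤ A N ^ 2 * (n : ℝ) ^ 2 := by positivity
  have hfi (j : ℕ) : Integrable (f j) μ := by
    have : Continuous (f j) := by fun_prop
    exact (this.intervalIntegrable 0 1).1
  have hgi (n : ℕ) : Integrable (g n) μ := by
    have h := ((intervalIntegrable_gaussKernel (ha n)).const_mul
      (Real.sqrt Real.pi * thetaCoeff n))
    have h2 : IntervalIntegrable (fun s => ((Real.sqrt Real.pi * thetaCoeff n *
      gaussKernel (A N ^ 2 * (n : ℝ) ^ 2) s : ℝ) : ℂ)) volume 0 1 := ⟨h.1.ofReal, h.2.ofReal⟩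
    exact (h2.continuousOn_mul (g := fun s : ℝ => cexp (s * u))
      (Continuous.continuousOn (by fun_prop))).1
  have hfs : Summable fun j => ∫ s, ‖f j s‖ ∂μ := by
    refine Summable.of_nonneg_of_le (fun j => integral_nonneg fun s => norm_nonneg _)
      (fun j => ?_) ((summable_one_div_tau_sq N).mul_left (Real.exp ρ * c))
    have ht := tau_pos N j
    calc ∫ s, ‖f j s‖ ∂μ
        ≤ ∫ s, Real.exp ρ * c * Real.exp (-(s * tau N j ^ 2)) ∂μ := by
          refine setIntegral_mono_on (hfi j).norm ?_ measurableSet_Ioc fun s hs => ?_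
          · exact (Continuous.intervalIntegrable (by fun_prop) 0 1).1
          · rw [hf, norm_mul, Complex.norm_real, Real.norm_of_nonneg (by positivity),
              mul_assoc (Real.exp ρ)]
            gcongr
            exact norm_cexp_mul_le h0 hu hs.1.le hs.2
      _ ≤ Real.exp ρ * c * (1 / tau N j ^ 2) := by
          rw [integral_const_mul]
          gcongr
          have := integral_exp_neg_mul_le (b := tau N j ^ 2) (by positivity)
          rwa [intervalIntegral.integral_of_le zero_le_one] at this
  have hgs : Summable fun n => ∫ s, ‖g n s‖ ∂μ := by
    -- The term `n = 0` has `a = 0`, where the bound `exp(-a)/a` is not available; summability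
    -- ignores it.
    rw [← summable_nat_add_iff 1]
    have hs := (summable_nat_add_iff 1).2 (summable_exp_neg_mul_nat_sq (c := A N ^ 2)
      (by positivity))
    refine Summable.of_nonneg_of_le (fun j => integral_nonneg fun s => norm_nonneg _)
      (fun n => ?_) (hs.mul_left (Real.exp ρ * (Real.sqrt Real.pi * 2) / A N ^ 2))
    set a : ℝ := A N ^ 2 * ((n + 1 : ℕ) : ℝ) ^ 2 with hadef
    have ha1 : A N ^ 2 ≤ a := by
      rw [hadef]
      refine le_mul_of_one_le_right (by positivity) (one_le_pow₀ ?_)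
      push_cast
      linarith [(Nat.cast_nonneg n : (0 : ℝ) ≤ n)]
    have ha0 : 0 < a := lt_of_lt_of_le (by positivity) ha1
    calc ∫ s, ‖g (n + 1) s‖ ∂μ
        ≤ ∫ s, Real.exp ρ * (Real.sqrt Real.pi * 2) * gaussKernel a s ∂μ := by
          refine setIntegral_mono_on (hgi _).norm ?_ measurableSet_Ioc fun s hs => ?_
          · exact ((intervalIntegrable_gaussKernel ha0.le).const_mul _).1
          · rw [hg, norm_mul, Complex.norm_real, Real.norm_eq_abs, abs_mul, abs_mul,
              abs_of_nonneg (gaussKernel_nonneg _ _), abs_of_nonneg (Real.sqrt_nonneg _),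
              mul_assoc (Real.exp ρ)]
            have h1 := gaussKernel_nonneg a s
            gcongr
            · exact norm_cexp_mul_le h0 hu hs.1.le hs.2
            · exact abs_thetaCoeff_le _
      _ ≤ Real.exp ρ * (Real.sqrt Real.pi * 2) * (Real.exp (-a) / A N ^ 2) := by
          rw [integral_const_mul]
          gcongr
          have := integral_gaussKernel_le ha0
          rw [intervalIntegral.integral_of_le zero_le_one] at this
          exact this.trans (by gcongr)
      _ = _ := by ring
  have e1 := hasSum_integral_of_summable_integral_norm hfi hfs
  have e2 := hasSum_integral_of_summable_integral_norm hgi hgs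
  have e3 : ∫ s, ∑' j, f j s ∂μ = ∫ s, ∑' n, g n s ∂μ := by
    refine setIntegral_congr_fun measurableSet_Ioc fun s hs => ?_
    simp only [hf, hg]
    rw [tsum_mul_left, tsum_mul_left, ← ofReal_tsum, ← ofReal_tsum, tsum_mul_left, hc,
      tsum_exp_tau_eq N hs.1, ← tsum_mul_left]
    congr 3
    funext n
    unfold gaussKernel
    ring
  rw [← e3] at e2
  refine ⟨_, e1.congr_fun fun j => ?_, e2.congr_fun fun n => ?_⟩
  · rw [intervalIntegral.integral_of_le zero_le_one, ← integral_const_mul]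
    refine integral_congr_ae (Eventually.of_forall fun s => ?_)
    simp only [hf]
    rw [mul_sub, sub_eq_add_neg, Complex.exp_add]
    push_cast
    ring
  · rw [kernelInt, intervalIntegral.integral_of_le zero_le_one, ← integral_const_mul]
    refine integral_congr_ae (Eventually.of_forall fun s => ?_)
    simp only [hg]
    push_cast
    ring

/-! ### The exact error formula -/

/-- The error of the modified midpoint rule with all its nodes, in the variable `w = rot * z`. -/
noncomputable def quadError (N : ℕ) (w : ℂ) : ℂ :=
  -(I * w / Real.sqrt Real.pi) *
    ∑' n : ℕ, (-1) ^ (n + 1) * kernelInt (A N ^ 2 * ((n + 1 : ℕ) : ℝ) ^ 2) (w ^ 2)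

/-- The contribution of the nodes beyond the first `N`, in the variable `w = rot * z`. -/
noncomputable def truncError (N : ℕ) (w : ℂ) : ℂ :=
  -(I * w / A N) * cexp (w ^ 2) *
    ∑' j : ℕ, cexp (-(tau N (N + j) : ℂ) ^ 2) / ((tau N (N + j) : ℂ) ^ 2 - w ^ 2)

theorem integral_cexp_mul {ζ : ℂ} (h : ζ ≠ 0) :
    ∫ s in (0 : ℝ)..1, cexp (s * ζ) = (cexp ζ - 1) / ζ := by
  have := integral_exp_mul_complex (a := 0) (b := 1) h
  simp only [mul_comm ζ, ofReal_one, one_mul, ofReal_zero, zero_mul, Complex.exp_zero] at this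
  exact this

theorem FNformula_eq (N : ℕ) (z : ℂ) :
    FNformula N z = 1 / 2 + I / 2 * Complex.tan (A N * (rot * z)) -
      I * (rot * z) / A N * cexp ((rot * z) ^ 2) *
        ∑ j ∈ Finset.range N, cexp (-(tau N j : ℂ) ^ 2) / ((tau N j : ℂ) ^ 2 - (rot * z) ^ 2) := by
  have hu : (rot * z) ^ 2 = I * z ^ 2 := by rw [mul_pow, rot_sq]
  have hsum : ∑ k ∈ Finset.Icc 1 N, cexp (-(node N k : ℂ) ^ 2) / (z ^ 2 + I * (node N k : ℂ) ^ 2) =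
      -I * ∑ j ∈ Finset.range N,
        cexp (-(tau N j : ℂ) ^ 2) / ((tau N j : ℂ) ^ 2 - (rot * z) ^ 2) := by
    rw [Finset.range_eq_Ico, Finset.sum_Ico_eq_sum_range, Finset.mul_sum,
      ← Finset.Ico_add_one_right_eq_Icc, Finset.sum_Ico_eq_sum_range]
    refine Finset.sum_congr (by simp) fun j _ => ?_
    have e : z ^ 2 + I * (tau N j : ℂ) ^ 2 = I * ((tau N j : ℂ) ^ 2 - (rot * z) ^ 2) := by
      rw [hu]
      linear_combination z ^ 2 * I_sq
    rw [add_comm 1 j, node_succ, zero_add, e, div_mul_eq_div_div_swap, div_eq_mul_inv _ I, inv_I]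
    ring
  unfold FNformula
  rw [hsum, mul_add I, Complex.exp_add, ← hu]
  have hr : cexp (I * (Real.pi / 4)) = rot := rfl
  rw [hr]
  have e2 : (A N : ℂ) * z * rot = A N * (rot * z) := by ring
  rw [e2]
  ring

/-- The error of `F_N` away from the zeros of `sin (2 A w)`. -/
theorem fresnelF_sub_FNformula (N : ℕ) {z : ℂ} (hz : Complex.sin (2 * (A N * (rot * z))) ≠ 0) :
    fresnelF z - FNformula N z = quadError N (rot * z) + truncError N (rot * z) := by
  set w := rot * z with hw
  have hA0 : (A N : ℂ) ≠ 0 := by exact_mod_cast (A_pos N).ne'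
  have hpi : (Real.pi : ℂ) ≠ 0 := by exact_mod_cast Real.pi_ne_zero
  have hspi : (Real.sqrt Real.pi : ℂ) ≠ 0 := by
    exact_mod_cast (Real.sqrt_pos.2 Real.pi_pos).ne'
  have hspi2 : (Real.sqrt Real.pi : ℂ) ^ 2 = Real.pi := by
    rw [← ofReal_pow, Real.sq_sqrt Real.pi_pos.le]
  have hw0 : w ≠ 0 := fun h => hz (by simp [h])
  obtain ⟨V, hV1, hV2⟩ := exists_hasSum_tau_and_hasSum_kernelInt N (w ^ 2)
  have hx : 2 * ((A N : ℂ) * w / Real.pi) ∈ integerComplement := by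
    rw [mem_integerComplement_iff]
    rintro ⟨n, hn⟩
    refine hz (Complex.sin_eq_zero_iff.2 ⟨n, ?_⟩)
    rw [hn]
    field_simp
  have hsub (j : ℕ) : (tau N j : ℂ) ^ 2 - w ^ 2 ≠ 0 := fun h => by
    rw [sub_eq_zero, sq_eq_sq_iff_eq_or_eq_neg] at h
    refine hz (Complex.sin_eq_zero_iff.2 ?_)
    rcases h with h | h
    · refine ⟨2 * j + 1, ?_⟩
      rw [← h, tau]
      push_cast
      field_simp
    · refine ⟨-(2 * j + 1), ?_⟩
      rw [eq_neg_iff_add_eq_zero, add_comm, ← eq_neg_iff_add_eq_zero] at h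
      rw [h, tau]
      push_cast
      field_simp
  -- Splitting off `n = 0`, whose theta coefficient is `1` instead of `±2`, isolates `F`.
  have hquad : quadError N w = fresnelF z - 1 / 2 - I * w / (2 * Real.pi) * V := by
    have h1 := (hasSum_nat_add_iff' 1).2 hV2
    have h2 := (h1.mul_left (1 / (2 * (Real.sqrt Real.pi : ℂ)))).tsum_eq
    have h3 (n : ℕ) : 1 / (2 * (Real.sqrt Real.pi : ℂ)) *
        (((Real.sqrt Real.pi * thetaCoeff (n + 1) : ℝ) : ℂ) *
          kernelInt (A N ^ 2 * ((n + 1 : ℕ) : ℝ) ^ 2) (w ^ 2)) =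
        (-1) ^ (n + 1) * kernelInt (A N ^ 2 * ((n + 1 : ℕ) : ℝ) ^ 2) (w ^ 2) := by
      rw [thetaCoeff, if_neg (Nat.succ_ne_zero n)]
      push_cast
      field_simp
    simp_rw [h3] at h2
    have h4 : thetaCoeff 0 = 1 := by rw [thetaCoeff, if_pos rfl]
    rw [Finset.sum_range_one, h4, Nat.cast_zero, zero_pow two_ne_zero, mul_zero, mul_one] at h2
    rw [quadError, h2, fresnelF_eq_kernelInt, ← hw, ← hspi2]
    field_simp
    ring
  have htan : HasSum (fun j : ℕ => 2 * (Real.pi : ℂ) * w / A N * (1 / ((tau N j : ℂ) ^ 2 - w ^ 2)))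
      (Real.pi * Complex.tan (A N * w)) := by
    have h := hasSum_pi_mul_tan hx
    rw [mul_div_cancel₀ _ hpi] at h
    refine h.congr_fun fun j => ?_
    have e : ((j : ℂ) + 1 / 2) ^ 2 - ((A N : ℂ) * w / Real.pi) ^ 2
        = ((A N : ℂ) / Real.pi) ^ 2 * ((tau N j : ℂ) ^ 2 - w ^ 2) := by
      unfold tau
      push_cast
      field_simp
    have := hsub j
    rw [e]
    field_simp
  set W : ℂ := 2 * Real.pi * w / A N * cexp (w ^ 2) with hW
  have hW0 : W ≠ 0 := mul_ne_zero (div_ne_zero (mul_ne_zero (mul_ne_zero two_ne_zero hpi) hw0) hA0)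
    (Complex.exp_ne_zero _)
  -- Subtracting `w` times the integrated node series from the tangent series cancels the `-1` in
  -- each `(exp(w² - τ²) - 1)/(w² - τ²)`. The factor `W` normalises what remains.
  have hall : HasSum (fun j : ℕ => cexp (-(tau N j : ℂ) ^ 2) / ((tau N j : ℂ) ^ 2 - w ^ 2))
      ((Real.pi * Complex.tan (A N * w) - w * V) / W) := by
    refine ((htan.sub (hV1.mul_left w)).div_const W).congr_fun fun j => ?_
    have h1 := hsub j
    have h2 : w ^ 2 - (tau N j : ℂ) ^ 2 ≠ 0 := fun h => h1 (by rw [← neg_sub, h, neg_zero])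
    have h3 := Complex.exp_ne_zero (w ^ 2)
    have h4 : cexp (w ^ 2 - (tau N j : ℂ) ^ 2) = cexp (w ^ 2) * cexp (-(tau N j : ℂ) ^ 2) := by
      rw [← Complex.exp_add, sub_eq_add_neg]
    rw [integral_cexp_mul h2, h4, ← neg_sub ((tau N j : ℂ) ^ 2) (w ^ 2), hW]
    push_cast
    field_simp
    ring
  have htrunc := ((hasSum_nat_add_iff' N).2 hall).tsum_eq
  simp_rw [add_comm _ N] at htrunc
  rw [truncError, htrunc, hquad, FNformula_eq, ← hw]
  have hWI : -(I * w / A N) * cexp (w ^ 2) = -(I / (2 * Real.pi)) * W := by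
    rw [hW]
    field_simp
  have hWI2 : I * w / A N * cexp (w ^ 2) = I / (2 * Real.pi) * W := by
    rw [hW]
    field_simp
  rw [hWI, hWI2]
  field_simp
  ring

/-! ### Bounds -/

/-- Since `(n+1)² ≥ 1 + 2n`, the series is dominated by a geometric one, the source of `1/(1 -
exp(-2A²))` in `c_N`. -/
theorem exp_neg_A_sq_mul_le (N n : ℕ) :
    Real.exp (-(A N ^ 2 * ((n + 1 : ℕ) : ℝ) ^ 2)) ≤
      Real.exp (-A N ^ 2) * Real.exp (-(2 * A N ^ 2)) ^ n := by
  rw [← Real.exp_nat_mul, ← Real.exp_add]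
  apply Real.exp_le_exp.2
  push_cast
  nlinarith [mul_nonneg (sq_nonneg (A N)) (sq_nonneg (n : ℝ))]

theorem hasSum_exp_A_sq (N : ℕ) :
    HasSum (fun n : ℕ => Real.exp (-A N ^ 2) * Real.exp (-(2 * A N ^ 2)) ^ n)
      (Real.exp (-A N ^ 2) / (1 - Real.exp (-(2 * A N ^ 2)))) := by
  have hA := A_pos N
  refine (hasSum_geometric_of_lt_one (Real.exp_pos _).le ?_).mul_left _
  rw [Real.exp_lt_one_iff]
  have : 0 < A N ^ 2 := by positivity
  linarith

theorem norm_quadError_le_of_forall {N : ℕ} {w : ℂ} {B : ℝ} (hB : 0 ≤ B)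
    (h : ∀ n : ℕ, ‖w * kernelInt (A N ^ 2 * ((n + 1 : ℕ) : ℝ) ^ 2) (w ^ 2)‖ ≤
      B * Real.exp (-(A N ^ 2 * ((n + 1 : ℕ) : ℝ) ^ 2))) :
    ‖quadError N w‖ ≤ B / Real.sqrt Real.pi *
      (Real.exp (-A N ^ 2) / (1 - Real.exp (-(2 * A N ^ 2)))) := by
  have e : quadError N w = -(I / Real.sqrt Real.pi) * ∑' n : ℕ, (-1) ^ (n + 1) *
      (w * kernelInt (A N ^ 2 * ((n + 1 : ℕ) : ℝ) ^ 2) (w ^ 2)) := by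
    have : ∀ n : ℕ, (-1 : ℂ) ^ (n + 1) * (w * kernelInt (A N ^ 2 * ((n + 1 : ℕ) : ℝ) ^ 2) (w ^ 2)) =
        w * ((-1) ^ (n + 1) * kernelInt (A N ^ 2 * ((n + 1 : ℕ) : ℝ) ^ 2) (w ^ 2)) := fun n => by
      ring
    simp_rw [this]
    rw [tsum_mul_left, quadError]
    ring
  have h1 := tsum_of_norm_bounded ((hasSum_exp_A_sq N).mul_left B)
    (f := fun n : ℕ => (-1 : ℂ) ^ (n + 1) *
      (w * kernelInt (A N ^ 2 * ((n + 1 : ℕ) : ℝ) ^ 2) (w ^ 2))) (fun n => by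
      rw [norm_mul, norm_pow, norm_neg, norm_one, one_pow, one_mul]
      exact (h n).trans (by gcongr; exact exp_neg_A_sq_mul_le N n))
  rw [e, norm_mul, norm_neg, norm_div, norm_I, Complex.norm_real,
    Real.norm_of_nonneg (Real.sqrt_nonneg _)]
  calc _ ≤ 1 / Real.sqrt Real.pi *
        (B * (Real.exp (-A N ^ 2) / (1 - Real.exp (-(2 * A N ^ 2))))) := by gcongr
    _ = _ := by ring

theorem A_sq_le (N n : ℕ) : A N ^ 2 ≤ A N ^ 2 * ((n + 1 : ℕ) : ℝ) ^ 2 := by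
  refine le_mul_of_one_le_right (sq_nonneg _) (one_le_pow₀ ?_)
  push_cast
  linarith [(Nat.cast_nonneg n : (0 : ℝ) ≤ n)]

theorem half_le_A_sq (N : ℕ) : 1 / 2 ≤ A N ^ 2 := by
  rw [A_sq]
  have h1 := Real.pi_gt_three
  have h2 : (0 : ℝ) ≤ N := N.cast_nonneg
  nlinarith

theorem norm_mul_kernelInt_sq_le {N : ℕ} {w : ℂ} {ρ : ℝ} (h0 : 0 ≤ ρ) (hw : (w ^ 2).re ≤ ρ)
    (n : ℕ) : ‖w * kernelInt (A N ^ 2 * ((n + 1 : ℕ) : ℝ) ^ 2) (w ^ 2)‖ ≤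
      Real.exp ρ * ‖w‖ / A N ^ 2 * Real.exp (-(A N ^ 2 * ((n + 1 : ℕ) : ℝ) ^ 2)) := by
  have hA := A_pos N
  have h1 := A_sq_le N n
  set a := A N ^ 2 * ((n + 1 : ℕ) : ℝ) ^ 2
  have ha : 0 < a := lt_of_lt_of_le (by positivity) h1
  rw [norm_mul]
  calc ‖w‖ * ‖kernelInt a (w ^ 2)‖ ≤ ‖w‖ * (Real.exp ρ * (Real.exp (-a) / a)) := by
        gcongr
        exact norm_kernelInt_le ha h0 hw
    _ ≤ ‖w‖ * (Real.exp ρ * (Real.exp (-a) / A N ^ 2)) := by gcongr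
    _ = _ := by ring

theorem norm_quadError_le_norm {N : ℕ} {w : ℂ} {ρ : ℝ} (h0 : 0 ≤ ρ) (hw : (w ^ 2).re ≤ ρ) :
    ‖quadError N w‖ ≤ Real.exp ρ * ‖w‖ / A N ^ 2 / Real.sqrt Real.pi *
      (Real.exp (-A N ^ 2) / (1 - Real.exp (-(2 * A N ^ 2)))) :=
  norm_quadError_le_of_forall (by positivity) (norm_mul_kernelInt_sq_le h0 hw)

/-- The geometric mean of the two kernel bounds: one grows like `|w|`, the other decays like
`1/|w|`, so their product is independent of `w`. -/
theorem norm_quadError_le {N : ℕ} {w : ℂ} {ρ : ℝ} (h0 : 0 ≤ ρ) (hw : (w ^ 2).re ≤ ρ) :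
    ‖quadError N w‖ ≤ Real.sqrt 2 * Real.exp ρ / A N / Real.sqrt Real.pi *
      (Real.exp (-A N ^ 2) / (1 - Real.exp (-(2 * A N ^ 2)))) := by
  have hA := A_pos N
  refine norm_quadError_le_of_forall (by positivity) fun n => ?_
  have h1 := norm_mul_kernelInt_sq_le h0 hw n (N := N)
  have h2 := norm_mul_kernelInt_le ((half_le_A_sq N).trans (A_sq_le N n)) h0 hw
  set a := A N ^ 2 * ((n + 1 : ℕ) : ℝ) ^ 2
  set k := kernelInt a (w ^ 2)
  refine le_of_sq_le_sq ?_ (by positivity)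
  have e : ‖w * k‖ ^ 2 * ‖w‖ = ‖w * k‖ * ‖w ^ 2 * k‖ := by
    rw [norm_mul, norm_mul, norm_pow]
    ring
  rcases eq_or_ne w 0 with h | h
  · rw [h, zero_mul, norm_zero, zero_pow two_ne_zero]
    positivity
  · have hw0 : 0 < ‖w‖ := norm_pos_iff.2 h
    refine le_of_mul_le_mul_right ?_ hw0
    rw [e]
    calc ‖w * k‖ * ‖w ^ 2 * k‖
        ≤ (Real.exp ρ * ‖w‖ / A N ^ 2 * Real.exp (-a)) * (2 * Real.exp ρ * Real.exp (-a)) := by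
          gcongr
      _ = _ := by
          rw [mul_pow, div_pow, mul_pow, Real.sq_sqrt (by norm_num)]
          ring

theorem summable_exp_neg_tau_sq_shift (N : ℕ) :
    Summable fun j : ℕ => Real.exp (-tau N (N + j) ^ 2) := by
  have h := (summable_nat_add_iff N).2 (summable_exp_neg_mul_tau_sq N one_pos)
  refine h.congr fun j => ?_
  rw [one_mul, add_comm]

/-- Expanding `(A + jπ/A)²` shows that the Gaussian weights decay at least like `exp(-2πj)`. The
geometric sum is then simplified by `exp(2π) ≥ 1 + 2π`. -/
theorem norm_truncError_le {N : ℕ} {w : ℂ} {K : ℝ} (hK : 0 ≤ K)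
    (h : ∀ t : ℝ, A N ≤ t → ‖w‖ / ‖(t : ℂ) ^ 2 - w ^ 2‖ ≤ K / t) :
    ‖truncError N w‖ ≤ Real.exp (w ^ 2).re * K * (2 * Real.pi + 1) / (2 * Real.pi) *
      (Real.exp (-A N ^ 2) / A N ^ 2) := by
  have hA := A_pos N
  have hpi := Real.pi_pos
  have hAt (j : ℕ) : A N ≤ tau N (N + j) := by
    rw [tau_add]
    have : 0 ≤ (j : ℝ) * (Real.pi / A N) := by positivity
    linarith
  have hexp (j : ℕ) : Real.exp (-tau N (N + j) ^ 2) ≤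
      Real.exp (-A N ^ 2) * Real.exp (-(2 * Real.pi)) ^ j := by
    rw [← Real.exp_nat_mul, ← Real.exp_add]
    apply Real.exp_le_exp.2
    have e : tau N (N + j) ^ 2 = A N ^ 2 + 2 * j * Real.pi + (j * (Real.pi / A N)) ^ 2 := by
      rw [tau_add]
      field_simp
      ring
    rw [e]
    nlinarith [sq_nonneg (j * (Real.pi / A N))]
  have hgeom := (hasSum_geometric_of_lt_one (Real.exp_pos (-(2 * Real.pi))).le
    (Real.exp_lt_one_iff.2 (by linarith))).mul_left (K / A N * Real.exp (-A N ^ 2))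
  have e : truncError N w = -(I / A N) * cexp (w ^ 2) *
      ∑' j : ℕ, w * (cexp (-(tau N (N + j) : ℂ) ^ 2) / ((tau N (N + j) : ℂ) ^ 2 - w ^ 2)) := by
    rw [tsum_mul_left, truncError]
    ring
  have hsum := tsum_of_norm_bounded hgeom
    (f := fun j : ℕ => w * (cexp (-(tau N (N + j) : ℂ) ^ 2) / ((tau N (N + j) : ℂ) ^ 2 - w ^ 2)))
    (fun j => by
      have e1 : ‖cexp (-(tau N (N + j) : ℂ) ^ 2)‖ = Real.exp (-tau N (N + j) ^ 2) := by
        rw [← ofReal_pow, ← ofReal_neg, Complex.norm_exp_ofReal]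
      have ht := tau_pos N (N + j)
      rw [norm_mul, norm_div, e1]
      calc ‖w‖ * (Real.exp (-tau N (N + j) ^ 2) / ‖(tau N (N + j) : ℂ) ^ 2 - w ^ 2‖)
          = ‖w‖ / ‖(tau N (N + j) : ℂ) ^ 2 - w ^ 2‖ * Real.exp (-tau N (N + j) ^ 2) := by ring
        _ ≤ K / A N * (Real.exp (-A N ^ 2) * Real.exp (-(2 * Real.pi)) ^ j) := by
            refine mul_le_mul ((h _ (hAt j)).trans ?_) (hexp j) (Real.exp_pos _).le (by positivity)
            have := hAt j
            gcongr
        _ = _ := by ring)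
  have hinv : (1 - Real.exp (-(2 * Real.pi)))⁻¹ ≤ (2 * Real.pi + 1) / (2 * Real.pi) := by
    rw [inv_le_comm₀ (by simpa using hpi) (by positivity), inv_div, Real.exp_neg]
    have h1 := Real.add_one_le_exp (2 * Real.pi)
    have h2 : (Real.exp (2 * Real.pi))⁻¹ ≤ (2 * Real.pi + 1)⁻¹ := by gcongr
    have h3 : 2 * Real.pi / (2 * Real.pi + 1) = 1 - (2 * Real.pi + 1)⁻¹ := by
      field_simp
      ring
    linarith
  rw [e, norm_mul, norm_mul, norm_neg, norm_div, norm_I, Complex.norm_real,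
    Real.norm_of_nonneg hA.le, Complex.norm_exp]
  calc _ ≤ 1 / A N * Real.exp (w ^ 2).re * (K / A N * Real.exp (-A N ^ 2) *
        ((2 * Real.pi + 1) / (2 * Real.pi))) := by
        gcongr
        exact hsum.trans (by gcongr)
    _ = _ := by ring

/-! ### Differentiability -/

theorem differentiable_quadError (N : ℕ) : Differentiable ℂ (quadError N) := by
  intro w
  have hA := A_pos N
  -- The added `1` leaves room for a neighbourhood of `w` on which the series converges uniformly.
  set M : ℝ := max 0 (w ^ 2).re + 1 with hM
  have hM0 : 0 ≤ M := by positivity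
  have hopen : IsOpen {w : ℂ | (w ^ 2).re < M} :=
    isOpen_lt (Complex.continuous_re.comp (continuous_pow 2)) continuous_const
  have hmem : w ∈ {w : ℂ | (w ^ 2).re < M} := by
    change (w ^ 2).re < M
    linarith [le_max_right 0 (w ^ 2).re]
  have hterm (n : ℕ) : Differentiable ℂ fun w : ℂ =>
      (-1) ^ (n + 1) * kernelInt (A N ^ 2 * ((n + 1 : ℕ) : ℝ) ^ 2) (w ^ 2) := by
    have hk : Differentiable ℂ (kernelInt (A N ^ 2 * ((n + 1 : ℕ) : ℝ) ^ 2)) :=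
      differentiable_kernelInt (by positivity)
    have hp : Differentiable ℂ fun w : ℂ => w ^ 2 := by fun_prop
    exact (hk.comp hp).const_mul _
  have hbound (n : ℕ) (w : ℂ) (hw : w ∈ {w : ℂ | (w ^ 2).re < M}) :
      ‖(-1) ^ (n + 1) * kernelInt (A N ^ 2 * ((n + 1 : ℕ) : ℝ) ^ 2) (w ^ 2)‖ ≤
      Real.exp M / A N ^ 2 * (Real.exp (-A N ^ 2) * Real.exp (-(2 * A N ^ 2)) ^ n) := by
    have h1 := A_sq_le N n
    have ha : 0 < A N ^ 2 * ((n + 1 : ℕ) : ℝ) ^ 2 := lt_of_lt_of_le (by positivity) h1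
    rw [norm_mul, norm_pow, norm_neg, norm_one, one_pow, one_mul]
    refine (norm_kernelInt_le ha hM0 (le_of_lt hw)).trans ?_
    rw [div_mul_eq_mul_div, ← mul_div_assoc]
    gcongr
    exact exp_neg_A_sq_mul_le N n
  have hd := differentiableOn_tsum_of_summable_norm
    ((hasSum_exp_A_sq N).summable.mul_left (Real.exp M / A N ^ 2))
    (fun n => (hterm n).differentiableOn) hopen hbound
  have h2 := hd.differentiableAt (hopen.mem_nhds hmem)
  have h3 : Differentiable ℂ fun w : ℂ => -(I * w / Real.sqrt Real.pi) := by fun_prop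
  exact (h3 w).mul h2

theorem differentiableOn_truncError {N : ℕ} {U : Set ℂ} (hU : IsOpen U) {δ : ℝ} (hδ : 0 < δ)
    (h : ∀ w ∈ U, ∀ t : ℝ, A N ≤ t → δ ≤ ‖(t : ℂ) ^ 2 - w ^ 2‖) :
    DifferentiableOn ℂ (truncError N) U := by
  have hA := A_pos N
  have hpi := Real.pi_pos
  have hAt (j : ℕ) : A N ≤ tau N (N + j) := by
    rw [tau_add]
    have : 0 ≤ (j : ℝ) * (Real.pi / A N) := by positivity
    linarith
  have hne (w : ℂ) (hw : w ∈ U) (j : ℕ) : (tau N (N + j) : ℂ) ^ 2 - w ^ 2 ≠ 0 :=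
    norm_pos_iff.1 (hδ.trans_le (h w hw _ (hAt j)))
  have hd := differentiableOn_tsum_of_summable_norm (U := U)
    (F := fun j (w : ℂ) => cexp (-(tau N (N + j) : ℂ) ^ 2) / ((tau N (N + j) : ℂ) ^ 2 - w ^ 2))
    ((summable_exp_neg_tau_sq_shift N).mul_left (1 / δ))
    (fun j => by
      have h1 : Differentiable ℂ fun w : ℂ => (tau N (N + j) : ℂ) ^ 2 - w ^ 2 := by fun_prop
      exact (differentiableOn_const _).div h1.differentiableOn fun w hw => hne w hw j) hU
    (fun j w hw => by
      have e1 : ‖cexp (-(tau N (N + j) : ℂ) ^ 2)‖ = Real.exp (-tau N (N + j) ^ 2) := by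
        rw [← ofReal_pow, ← ofReal_neg, Complex.norm_exp_ofReal]
      rw [norm_div, e1, div_eq_mul_one_div, mul_comm]
      gcongr
      exact h w hw _ (hAt j))
  have h2 : Differentiable ℂ fun w : ℂ => -(I * w / A N) * cexp (w ^ 2) := by fun_prop
  exact h2.differentiableOn.mul hd

/-! ### Removal of the singularities -/

/-- The zeros are simple, hence isolated, so a punctured limit never meets the points excluded from
the error formula. -/
theorem eventually_sin_ne_zero (N : ℕ) (z : ℂ) :
    ∀ᶠ z' in 𝓝[≠] z, Complex.sin (2 * (A N * (rot * z'))) ≠ 0 := by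
  have hA0 : (A N : ℂ) ≠ 0 := by exact_mod_cast (A_pos N).ne'
  have h1 : HasDerivAt (fun z' : ℂ => 2 * ((A N : ℂ) * (rot * z'))) (2 * (A N * (rot * 1))) z :=
    (((hasDerivAt_id z).const_mul rot).const_mul (A N : ℂ)).const_mul 2
  have h2 := (Complex.hasDerivAt_sin (2 * ((A N : ℂ) * (rot * z)))).comp z h1
  by_cases hs : Complex.sin (2 * ((A N : ℂ) * (rot * z))) = 0
  · refine h2.eventually_ne (mul_ne_zero (fun hc => ?_)
      (mul_ne_zero two_ne_zero (mul_ne_zero hA0 (mul_ne_zero rot_ne_zero one_ne_zero))))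
    have := Complex.sin_sq_add_cos_sq (2 * ((A N : ℂ) * (rot * z)))
    rw [hs, hc] at this
    simp at this
  · exact (h2.continuousAt.eventually_ne hs).filter_mono nhdsWithin_le_nhds

/-- The right-hand side is continuous at `z` and agrees with the formula for `F_N` on a punctured
neighbourhood, so it is the limit that defines `FN`. -/
theorem FN_eq_sub {N : ℕ} {z : ℂ} (h : DifferentiableAt ℂ (truncError N) (rot * z)) :
    FN N z = fresnelF z - quadError N (rot * z) - truncError N (rot * z) := by
  have hc : ContinuousAt
      (fun z => fresnelF z - quadError N (rot * z) - truncError N (rot * z)) z := by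
    have hr : ContinuousAt (fun z : ℂ => rot * z) z := by fun_prop
    exact ((differentiable_fresnelF z).continuousAt.sub
      (((differentiable_quadError N).continuous.continuousAt).comp hr)).sub
      (ContinuousAt.comp (f := fun z : ℂ => rot * z) (g := truncError N) h.continuousAt hr)
  refine Tendsto.limUnder_eq ((hc.mono_left nhdsWithin_le_nhds).congr' ?_)
  filter_upwards [eventually_sin_ne_zero N z] with z' hz'
  linear_combination fresnelF_sub_FNformula N hz'

theorem FN_eq_FNformula {N : ℕ} {z : ℂ} (h : ContinuousAt (FNformula N) z) :
    FN N z = FNformula N z :=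
  (h.mono_left nhdsWithin_le_nhds).limUnder_eq

theorem sub_re_le_norm_sq_sub (t : ℝ) (w : ℂ) :
    t ^ 2 - (w ^ 2).re ≤ ‖(t : ℂ) ^ 2 - w ^ 2‖ := by
  have := Complex.re_le_norm ((t : ℂ) ^ 2 - w ^ 2)
  rwa [Complex.sub_re, ← ofReal_pow, Complex.ofReal_re, ofReal_pow] at this

theorem differentiableAt_truncError_of_re {N : ℕ} {w : ℂ} (hw : (w ^ 2).re < A N ^ 2) :
    DifferentiableAt ℂ (truncError N) w := by
  have hA := A_pos N
  set δ := (A N ^ 2 - (w ^ 2).re) / 2 with hδ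
  have hU : IsOpen {w : ℂ | (w ^ 2).re < A N ^ 2 - δ} :=
    isOpen_lt (Complex.continuous_re.comp (continuous_pow 2)) continuous_const
  refine (differentiableOn_truncError hU (δ := δ) (by linarith) fun w hw t ht => ?_).differentiableAt
    (hU.mem_nhds ?_)
  · have h1 := sub_re_le_norm_sq_sub t w
    have h2 : (w ^ 2).re < A N ^ 2 - δ := hw
    nlinarith
  · change (w ^ 2).re < A N ^ 2 - δ
    linarith

theorem abs_re_sub_im_le (x : ℂ) : |x.re - x.im| / Real.sqrt 2 ≤ ‖x‖ := by
  rw [div_le_iff₀ (by positivity), Complex.norm_def, ← Real.sqrt_mul (Complex.normSq_nonneg _)]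
  apply Real.abs_le_sqrt
  rw [Complex.normSq_apply]
  nlinarith [sq_nonneg (x.re + x.im)]

/-- The distance to the line `Re = Im` is `|Re - Im|/√2`. In the variable `z` that line is the real
axis, which makes this the right measure for a strip in `|Im z|`. -/
theorem le_norm_sub_and_add (t : ℝ) (w : ℂ) :
    (t - |w.re - w.im|) / Real.sqrt 2 ≤ ‖(t : ℂ) - w‖ ∧
    (t - |w.re - w.im|) / Real.sqrt 2 ≤ ‖(t : ℂ) + w‖ := by
  constructor
  · refine le_trans ?_ (abs_re_sub_im_le _)
    gcongr
    simp only [Complex.sub_re, Complex.sub_im, Complex.ofReal_re, Complex.ofReal_im]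
    have h1 := le_abs_self (w.re - w.im)
    have h2 := le_abs_self (t - w.re - (0 - w.im))
    linarith
  · refine le_trans ?_ (abs_re_sub_im_le _)
    gcongr
    simp only [Complex.add_re, Complex.add_im, Complex.ofReal_re, Complex.ofReal_im]
    have h1 := neg_abs_le (w.re - w.im)
    have h2 := le_abs_self (t + w.re - (0 + w.im))
    linarith

theorem norm_sq_sub_sq (t : ℝ) (w : ℂ) :
    ‖(t : ℂ) ^ 2 - w ^ 2‖ = ‖(t : ℂ) + w‖ * ‖(t : ℂ) - w‖ := by
  rw [sq_sub_sq, norm_mul]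

theorem differentiableAt_truncError_of_abs {N : ℕ} {w : ℂ} (hw : |w.re - w.im| < A N) :
    DifferentiableAt ℂ (truncError N) w := by
  set δ := (A N - |w.re - w.im|) / 2 with hδ
  have hδ0 : 0 < δ := by linarith
  have hU : IsOpen {w : ℂ | |w.re - w.im| < A N - δ} :=
    isOpen_lt (Complex.continuous_re.sub Complex.continuous_im).abs continuous_const
  refine (differentiableOn_truncError hU (δ := δ / Real.sqrt 2 * (δ / Real.sqrt 2))
    (by positivity) fun w hw t ht => ?_).differentiableAt (hU.mem_nhds ?_)
  · have h2 : |w.re - w.im| < A N - δ := hw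
    have h3 : δ / Real.sqrt 2 ≤ (t - |w.re - w.im|) / Real.sqrt 2 := by
      gcongr
      linarith
    rw [norm_sq_sub_sq]
    gcongr
    · exact h3.trans (le_norm_sub_and_add t w).2
    · exact h3.trans (le_norm_sub_and_add t w).1
  · change |w.re - w.im| < A N - δ
    linarith

/-! ### Error bounds -/

/-- The unit in which the quadrature error is measured. -/
noncomputable def quadUnit (N : ℕ) : ℝ :=
  Real.exp (-A N ^ 2) / (1 - Real.exp (-(2 * A N ^ 2))) / (A N * Real.sqrt Real.pi)

/-- The unit in which the truncation error is measured. -/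
noncomputable def truncUnit (N : ℕ) : ℝ :=
  (2 * Real.pi + 1) / (2 * Real.pi) * (Real.exp (-A N ^ 2) / A N ^ 2)

theorem one_sub_exp_pos (N : ℕ) : 0 < 1 - Real.exp (-(2 * A N ^ 2)) := by
  have hA := A_pos N
  rw [sub_pos, Real.exp_lt_one_iff, neg_lt_zero]
  positivity

theorem quadUnit_pos (N : ℕ) : 0 < quadUnit N := by
  have hA := A_pos N
  have hpi := Real.pi_pos
  have := one_sub_exp_pos N
  unfold quadUnit
  positivity

theorem truncUnit_pos (N : ℕ) : 0 < truncUnit N := by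
  have hA := A_pos N
  have hpi := Real.pi_pos
  unfold truncUnit
  positivity

theorem rate_eq (N : ℕ) : Real.exp (-(Real.pi * N)) / Real.sqrt ((N : ℝ) + 1 / 2) =
    Real.exp (-A N ^ 2) * Real.exp (Real.pi / 2) * Real.sqrt Real.pi / A N := by
  have hpi := Real.pi_pos
  have hA : A N = Real.sqrt ((N : ℝ) + 1 / 2) * Real.sqrt Real.pi :=
    Real.sqrt_mul (by positivity) _
  have h1 : Real.exp (-(Real.pi * N)) = Real.exp (-A N ^ 2) * Real.exp (Real.pi / 2) := by
    rw [← Real.exp_add, A_sq]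
    congr 1
    ring
  have h2 : Real.sqrt Real.pi ≠ 0 := by positivity
  have h3 : Real.sqrt ((N : ℝ) + 1 / 2) ≠ 0 := by positivity
  rw [h1, hA]
  field_simp

theorem pi_rpow_three_half : Real.pi ^ (3 / 2 : ℝ) = Real.pi * Real.sqrt Real.pi := by
  rw [Real.sqrt_eq_rpow, ← Real.rpow_one_add' Real.pi_pos.le (by norm_num)]
  norm_num

/-- The factor `1 + 2√π exp(-β A²)` in `c_N` is slack for this method and is bounded below by `1`.
-/
theorem le_c_mul_rate (N : ℕ) :
    20 * Real.sqrt 2 / 9 * quadUnit N + 1 / Real.sqrt 2 * truncUnit N ≤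
      c N * (Real.exp (-(Real.pi * N)) / Real.sqrt ((N : ℝ) + 1 / 2)) := by
  have hA := A_pos N
  have hpi := Real.pi_pos
  have hq := one_sub_exp_pos N
  have hs : 0 < Real.sqrt Real.pi := by positivity
  have hs2 : Real.sqrt Real.pi ^ 2 = Real.pi := Real.sq_sqrt hpi.le
  have h2 : 0 < Real.sqrt 2 := by positivity
  have he : Real.exp (-(Real.pi / 2)) = (Real.exp (Real.pi / 2))⁻¹ := Real.exp_neg _
  have key : c N * (Real.exp (-(Real.pi * N)) / Real.sqrt ((N : ℝ) + 1 / 2)) =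
      20 * Real.sqrt 2 / 9 * quadUnit N *
        (1 + 2 * Real.sqrt Real.pi * Real.exp (-(beta * A N ^ 2)))
      + 1 / Real.sqrt 2 * truncUnit N := by
    rw [rate_eq, c, he, pi_rpow_three_half, quadUnit, truncUnit]
    field_simp
    linear_combination (20 * Real.sqrt 2 ^ 2 * 2 * A N *
      (1 + 2 * Real.sqrt Real.pi * Real.exp (-(A N ^ 2 * beta)))) * hs2
  rw [key]
  have hu := quadUnit_pos N
  refine add_le_add (le_mul_of_one_le_right (by positivity) ?_) le_rfl
  have : 0 ≤ 2 * Real.sqrt Real.pi * Real.exp (-(beta * A N ^ 2)) := by positivity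
  linarith

/-- The extra summand of `ĉ_N`, times the rate, is exactly the `truncUnit` term; the truncation part
of `c_N` is discarded. -/
theorem le_cHat_mul_rate (N : ℕ) :
    20 * Real.sqrt 2 / 9 * quadUnit N + 2 * Real.sqrt 2 * Real.sqrt Real.pi * truncUnit N ≤
      cHat N * (Real.exp (-(Real.pi * N)) / Real.sqrt ((N : ℝ) + 1 / 2)) := by
  have hA := A_pos N
  have hpi := Real.pi_pos
  have hs : 0 < Real.sqrt Real.pi := by positivity
  have h2 : 0 < Real.sqrt 2 := by positivity
  have hs2 : Real.sqrt Real.pi ^ 2 = Real.pi := Real.sq_sqrt hpi.le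
  have hr : Real.sqrt ((N : ℝ) + 1 / 2) = A N / Real.sqrt Real.pi := by
    have hA : A N = Real.sqrt ((N : ℝ) + 1 / 2) * Real.sqrt Real.pi :=
      Real.sqrt_mul (by positivity) _
    rw [hA]
    field_simp
  have h1 := le_c_mul_rate N
  have h3 : Real.sqrt 2 * (2 * Real.pi + 1) /
      (Real.pi ^ (3 / 2 : ℝ) * Real.exp (Real.pi / 2) * Real.sqrt ((N : ℝ) + 1 / 2)) *
      (Real.exp (-(Real.pi * N)) / Real.sqrt ((N : ℝ) + 1 / 2)) =
      2 * Real.sqrt 2 * Real.sqrt Real.pi * truncUnit N := by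
    rw [rate_eq, pi_rpow_three_half, truncUnit, hr]
    field_simp

  have h4 : 0 ≤ 1 / Real.sqrt 2 * truncUnit N := by
    have := truncUnit_pos N
    positivity
  rw [cHat, add_mul, h3]
  linarith

theorem re_rot_mul_sq (z : ℂ) : ((rot * z) ^ 2).re = -(2 * (z.re * z.im)) := by
  rw [mul_pow, rot_sq, sq]
  simp
  ring

theorem norm_rot_mul (z : ℂ) : ‖rot * z‖ = ‖z‖ := by rw [norm_mul, norm_rot, one_mul]

theorem fresnelF_sub_FN {N : ℕ} {z : ℂ} (h : DifferentiableAt ℂ (truncError N) (rot * z)) :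
    fresnelF z - FN N z = quadError N (rot * z) + truncError N (rot * z) := by
  rw [FN_eq_sub h]
  ring

theorem norm_quadError_le_unit {N : ℕ} {w : ℂ} {ρ : ℝ} (h0 : 0 ≤ ρ) (hw : (w ^ 2).re ≤ ρ) :
    ‖quadError N w‖ ≤ Real.exp ρ * (Real.sqrt 2 * quadUnit N) := by
  refine (norm_quadError_le h0 hw).trans (le_of_eq ?_)
  unfold quadUnit
  have hA := (A_pos N).ne'
  have hq := (one_sub_exp_pos N).ne'
  have hs : Real.sqrt Real.pi ≠ 0 := by have := Real.pi_pos; positivity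
  field_simp

theorem norm_truncError_le_unit {N : ℕ} {w : ℂ} {K ρ : ℝ} (hK : 0 ≤ K) (hw : (w ^ 2).re ≤ ρ)
    (h : ∀ t : ℝ, A N ≤ t → ‖w‖ / ‖(t : ℂ) ^ 2 - w ^ 2‖ ≤ K / t) :
    ‖truncError N w‖ ≤ Real.exp ρ * (K * truncUnit N) := by
  have hu := truncUnit_pos N
  refine (norm_truncError_le hK h).trans ?_
  have e : Real.exp (w ^ 2).re * K * (2 * Real.pi + 1) / (2 * Real.pi) *
      (Real.exp (-A N ^ 2) / A N ^ 2) = Real.exp (w ^ 2).re * (K * truncUnit N) := by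
    unfold truncUnit
    ring
  rw [e]
  gcongr

/-- When `Re w² ≤ 0`, `|t² - w²|² ≥ t⁴ + |w|⁴ ≥ 2 t² |w|²`. -/
theorem norm_div_norm_le_of_re_nonpos {w : ℂ} (hw : (w ^ 2).re ≤ 0) {t : ℝ} (ht : 0 < t) :
    ‖w‖ / ‖(t : ℂ) ^ 2 - w ^ 2‖ ≤ 1 / Real.sqrt 2 / t := by
  have hpos : 0 < ‖(t : ℂ) ^ 2 - w ^ 2‖ := by
    have := sub_re_le_norm_sq_sub t w
    nlinarith [sq_nonneg t, pow_pos ht 2]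
  have h2 : Real.sqrt 2 ^ 2 = 2 := Real.sq_sqrt (by norm_num)
  rw [div_div, div_le_div_iff₀ hpos (by positivity), one_mul]
  refine le_of_sq_le_sq ?_ (norm_nonneg _)
  have e : ‖(t : ℂ) ^ 2 - w ^ 2‖ ^ 2 = t ^ 4 - 2 * t ^ 2 * (w ^ 2).re + (‖w‖ ^ 2) ^ 2 := by
    rw [← norm_pow w 2, ← Complex.normSq_eq_norm_sq, ← Complex.normSq_eq_norm_sq,
      ← ofReal_pow, Complex.normSq_apply, Complex.normSq_apply]
    simp only [Complex.sub_re, Complex.sub_im, Complex.ofReal_re, Complex.ofReal_im]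
    ring
  rw [e, mul_pow, mul_pow, h2]
  nlinarith [sq_nonneg (t ^ 2 - ‖w‖ ^ 2), mul_nonneg (sq_nonneg t) (neg_nonneg.2 hw)]

theorem norm_le_max_norm_sub_add (t : ℝ) (w : ℂ) (ht : 0 ≤ t) :
    ‖w‖ ≤ ‖(t : ℂ) + w‖ ∨ ‖w‖ ≤ ‖(t : ℂ) - w‖ := by
  rcases le_total 0 w.re with h | h
  · left
    rw [Complex.norm_def, Complex.norm_def]
    apply Real.sqrt_le_sqrt
    simp only [Complex.normSq_apply, Complex.add_re, Complex.add_im, Complex.ofReal_re,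
      Complex.ofReal_im]
    nlinarith [mul_nonneg ht h]
  · right
    rw [Complex.norm_def, Complex.norm_def]
    apply Real.sqrt_le_sqrt
    simp only [Complex.normSq_apply, Complex.sub_re, Complex.sub_im, Complex.ofReal_re,
      Complex.ofReal_im]
    nlinarith [mul_nonneg ht (neg_nonneg.2 h)]

/-- In `|t + w| |t - w|`, the sign of `Re w` makes one factor at least `|w|`; the other is at least
`t/(2√2)` by the distance to the diagonal. -/
theorem norm_div_norm_le_of_abs {w : ℂ} {t : ℝ} (ht : 0 < t) (hw : |w.re - w.im| ≤ t / 2) :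
    ‖w‖ / ‖(t : ℂ) ^ 2 - w ^ 2‖ ≤ 2 * Real.sqrt 2 / t := by
  obtain ⟨h1, h2⟩ := le_norm_sub_and_add t w
  have h3 : t / 2 / Real.sqrt 2 ≤ (t - |w.re - w.im|) / Real.sqrt 2 := by
    gcongr
    linarith
  have h4 : 0 < t / 2 / Real.sqrt 2 := by positivity
  have h5 : ‖w‖ * (t / 2 / Real.sqrt 2) ≤ ‖(t : ℂ) ^ 2 - w ^ 2‖ := by
    rw [norm_sq_sub_sq]
    rcases norm_le_max_norm_sub_add t w ht.le with h | h
    · exact mul_le_mul h (h3.trans h1) h4.le (norm_nonneg _)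
    · rw [mul_comm ‖(t : ℂ) + w‖]
      exact mul_le_mul h (h3.trans h2) h4.le (norm_nonneg _)
  have hpos : 0 < ‖(t : ℂ) ^ 2 - w ^ 2‖ := by
    rw [norm_sq_sub_sq]
    exact mul_pos (h4.trans_le (h3.trans h2)) (h4.trans_le (h3.trans h1))
  rw [div_le_div_iff₀ hpos ht]
  calc ‖w‖ * t = 2 * Real.sqrt 2 * (‖w‖ * (t / 2 / Real.sqrt 2)) := by field_simp
    _ ≤ _ := by gcongr

theorem norm_div_norm_le_of_norm {w : ℂ} {t : ℝ} (ht : 0 < t) (hw : ‖w‖ ≤ t / 3) :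
    ‖w‖ / ‖(t : ℂ) ^ 2 - w ^ 2‖ ≤ 3 / 8 / t := by
  have h1 := norm_sub_norm_le ((t : ℂ) ^ 2) (w ^ 2)
  rw [norm_pow, norm_pow, Complex.norm_real, Real.norm_of_nonneg ht.le] at h1
  have h2 : 8 / 9 * t ^ 2 ≤ ‖(t : ℂ) ^ 2 - w ^ 2‖ := by
    nlinarith [norm_nonneg w]
  rw [div_le_div_iff₀ (lt_of_lt_of_le (by positivity) h2) ht]
  nlinarith

theorem norm_fresnelF_sub_FN_le_of_nonneg (N : ℕ) {z : ℂ} (hz : 0 ≤ z.re * z.im) :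
    ‖fresnelF z - FN N z‖ ≤
      c N * (Real.exp (-(Real.pi * N)) / Real.sqrt ((N : ℝ) + 1 / 2)) := by
  have hA := A_pos N
  have hw : ((rot * z) ^ 2).re ≤ 0 := by
    rw [re_rot_mul_sq]
    linarith
  rw [fresnelF_sub_FN (differentiableAt_truncError_of_re (hw.trans_lt (by positivity)))]
  have h1 := norm_quadError_le_unit le_rfl hw (N := N)
  have h2 := norm_truncError_le_unit (K := 1 / Real.sqrt 2) (by positivity) hw fun t ht =>
    norm_div_norm_le_of_re_nonpos hw (hA.trans_le ht)
  rw [Real.exp_zero, one_mul] at h1 h2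
  refine (norm_add_le _ _).trans ((add_le_add h1 h2).trans (le_trans ?_ (le_c_mul_rate N)))
  have := quadUnit_pos N
  have h3 : 0 < Real.sqrt 2 := by positivity
  gcongr
  linarith

theorem one_le_sqrt_pi : 1 ≤ Real.sqrt Real.pi := by
  rw [Real.one_le_sqrt]
  linarith [Real.pi_gt_three]

theorem norm_fresnelF_sub_FN_le_of_nonpos (N : ℕ) {z : ℂ} (hz : z.re * z.im ≤ 0)
    (hy : |z.im| ≤ A N / (2 * Real.sqrt 2)) :
    ‖fresnelF z - FN N z‖ ≤ cHat N * Real.exp (-(2 * (z.re * z.im))) *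
      (Real.exp (-(Real.pi * N)) / Real.sqrt ((N : ℝ) + 1 / 2)) := by
  have hA := A_pos N
  have h2 : Real.sqrt 2 ^ 2 = 2 := Real.sq_sqrt (by norm_num)
  have h20 : 0 < Real.sqrt 2 := by positivity
  have hab : |(rot * z).re - (rot * z).im| ≤ A N / 2 := by
    have e : (rot * z).re - (rot * z).im = -(Real.sqrt 2 * z.im) := by
      have e1 : rot * z = ((1 / Real.sqrt 2 : ℝ) : ℂ) * ((1 + I) * z) := by
        rw [rot_eq]
        push_cast
        ring
      rw [e1, Complex.re_ofReal_mul, Complex.im_ofReal_mul]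
      simp
      field_simp
      rw [h2]
      ring
    rw [e, abs_neg, abs_mul, abs_of_pos h20]
    calc Real.sqrt 2 * |z.im| ≤ Real.sqrt 2 * (A N / (2 * Real.sqrt 2)) := by gcongr
      _ = A N / 2 := by field_simp
  set ρ := -(2 * (z.re * z.im)) with hρ
  have hw : ((rot * z) ^ 2).re ≤ ρ := (re_rot_mul_sq z).le
  rw [fresnelF_sub_FN (differentiableAt_truncError_of_abs (by linarith))]
  have e1 := norm_quadError_le_unit (by linarith) hw (N := N)
  have e2 := norm_truncError_le_unit (K := 2 * Real.sqrt 2) (by positivity) hw fun t ht =>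
    norm_div_norm_le_of_abs (hA.trans_le ht) (hab.trans (by linarith))
  have e3 := le_cHat_mul_rate N
  have hq := quadUnit_pos N
  have ht := truncUnit_pos N
  refine (norm_add_le _ _).trans ((add_le_add e1 e2).trans ?_)
  rw [mul_comm (cHat N), mul_assoc (Real.exp ρ), ← mul_add]
  refine mul_le_mul_of_nonneg_left (le_trans (add_le_add ?_ ?_) e3) (Real.exp_pos _).le
  · gcongr
    linarith
  · exact mul_le_mul_of_nonneg_right (le_mul_of_one_le_right (by positivity) one_le_sqrt_pi) ht.le

/-- Equality holds at `N = 4`, where `A² = 9π/2`. -/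
theorem three_mul_le_A {N : ℕ} (hN : 4 ≤ N) : 3 * Real.sqrt (Real.pi / 2) ≤ A N := by
  refine Real.le_sqrt_of_sq_le ?_
  have hpi := Real.pi_pos
  have h : (4 : ℝ) ≤ N := by exact_mod_cast hN
  rw [mul_pow, Real.sq_sqrt (by positivity)]
  nlinarith

theorem norm_fresnelF_sub_FN_le_of_norm {N : ℕ} (hN : 4 ≤ N) {z : ℂ}
    (hz : ‖z‖ ≤ Real.sqrt (Real.pi / 2)) :
    ‖fresnelF z - FN N z‖ ≤ cHat N *
      (Real.exp (-(Real.pi * ((N : ℝ) - 1 / 4))) / Real.sqrt ((N : ℝ) + 1 / 2)) := by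
  have hA := A_pos N
  have hpi := Real.pi_pos
  have hwA : ‖rot * z‖ ≤ A N / 3 := by
    rw [norm_rot_mul]
    linarith [three_mul_le_A hN]
  have hw : ((rot * z) ^ 2).re ≤ Real.pi / 2 := by
    refine (Complex.re_le_norm _).trans ?_
    rw [norm_pow, norm_rot_mul]
    calc ‖z‖ ^ 2 ≤ Real.sqrt (Real.pi / 2) ^ 2 := by gcongr
      _ = _ := Real.sq_sqrt (by positivity)
  have hlt : ((rot * z) ^ 2).re < A N ^ 2 := by
    refine (Complex.re_le_norm _).trans_lt ?_
    rw [norm_pow]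
    have : ‖rot * z‖ < A N := by linarith
    gcongr
  rw [fresnelF_sub_FN (differentiableAt_truncError_of_re hlt)]
  have hq := quadUnit_pos N
  have ht := truncUnit_pos N
  -- On the disc `Re w²` is bounded only by `π/2`, while the target allows just `exp(π/4)`. The
  -- missing factor `exp(π/4) ≤ 3` is paid for by `|w| ≤ A/3`, which gives the constants `1/3` here
  -- and `3/8` for the tail.
  have e1 : ‖quadError N (rot * z)‖ ≤ Real.exp (Real.pi / 2) * (1 / 3 * quadUnit N) := by
    refine (norm_quadError_le_norm (by positivity) hw).trans ?_
    have hs : 0 < Real.sqrt Real.pi := by positivity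
    have h1 := one_sub_exp_pos N
    calc _ ≤ Real.exp (Real.pi / 2) * (A N / 3) / A N ^ 2 / Real.sqrt Real.pi *
          (Real.exp (-A N ^ 2) / (1 - Real.exp (-(2 * A N ^ 2)))) := by gcongr
      _ = _ := by
        unfold quadUnit
        field_simp
  have e2 := norm_truncError_le_unit (K := 3 / 8) (by norm_num) hw fun t ht =>
    norm_div_norm_le_of_norm (hA.trans_le ht) (hwA.trans (by linarith))
  have e3 := le_cHat_mul_rate N
  have e4 : Real.exp (-(Real.pi * ((N : ℝ) - 1 / 4))) =
      Real.exp (Real.pi / 4) * Real.exp (-(Real.pi * N)) := by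
    rw [← Real.exp_add]
    congr 1
    ring
  have e5 : Real.exp (Real.pi / 2) = Real.exp (Real.pi / 4) * Real.exp (Real.pi / 4) := by
    rw [← Real.exp_add]
    congr 1
    ring
  have e6 : Real.exp (Real.pi / 4) ≤ 3 := by
    have h1 : Real.exp (Real.pi / 4) ≤ Real.exp 1 :=
      Real.exp_le_exp.2 (by linarith [Real.pi_lt_four])
    linarith [Real.exp_one_lt_d9]
  have e7 : 1 ≤ Real.sqrt 2 := by
    rw [Real.one_le_sqrt]
    norm_num
  refine (norm_add_le _ _).trans ((add_le_add e1 e2).trans ?_)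
  rw [e4, mul_div_assoc, mul_left_comm (cHat N), ← mul_add, e5, mul_assoc]
  refine mul_le_mul_of_nonneg_left (le_trans ?_ e3) (Real.exp_pos _).le
  calc Real.exp (Real.pi / 4) * (1 / 3 * quadUnit N + 3 / 8 * truncUnit N)
      ≤ 3 * (1 / 3 * quadUnit N + 3 / 8 * truncUnit N) := by gcongr
    _ = 1 * quadUnit N + 9 / 8 * truncUnit N := by ring
    _ ≤ _ := by
      gcongr
      · linarith
      · nlinarith [one_le_sqrt_pi]

open ComplexConjugate

/-! ### Maclaurin coefficients -/

/-- Uniqueness of power series; stated over `RCLike` because it serves both the complex functions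
and the real `C`, `S`, `C_N`, `S_N`. -/
theorem macl_eq_of_hasSum {𝕜 : Type*} [RCLike 𝕜] {f : 𝕜 → 𝕜} {p : ℕ → 𝕜}
    (h : ∀ᶠ x in 𝓝 (0 : 𝕜), HasSum (fun n => p n * x ^ n) (f x)) (n : ℕ) : macl f n = p n := by
  have h1 : HasFPowerSeriesAt f (FormalMultilinearSeries.ofScalars 𝕜 p) 0 := by
    rw [hasFPowerSeriesAt_iff]
    filter_upwards [h] with x hx
    simpa only [FormalMultilinearSeries.coeff_ofScalars, smul_eq_mul, zero_add, mul_comm] using hx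
  have h2 := h1.analyticAt.hasFPowerSeriesAt.eq_formalMultilinearSeries h1
  have h3 := congrArg (fun q => FormalMultilinearSeries.coeff q n) h2
  simp only [FormalMultilinearSeries.coeff_ofScalars] at h3
  exact h3

theorem hasSum_macl {f : ℂ → ℂ} {r : ℝ} (hf : DifferentiableOn ℂ f (Metric.ball 0 r)) {z : ℂ}
    (hz : ‖z‖ < r) : HasSum (fun n => macl f n * z ^ n) (f z) := by
  refine (Complex.hasSum_taylorSeries_on_ball hf (mem_ball_zero_iff.2 hz)).congr_fun fun n => ?_
  rw [sub_zero, smul_eq_mul, smul_eq_mul, macl, div_eq_mul_inv]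
  ring

theorem norm_macl_sub_le {f g : ℂ → ℂ} {r R B : ℝ} (hr : 0 < r) (hrR : r < R)
    (hf : DifferentiableOn ℂ f (Metric.ball 0 R)) (hg : DifferentiableOn ℂ g (Metric.ball 0 R))
    (h : ∀ z : ℂ, ‖z‖ ≤ r → ‖f z - g z‖ ≤ B) (n : ℕ) :
    ‖macl f n - macl g n‖ ≤ B / r ^ n := by
  have h0 : Metric.ball (0 : ℂ) R ∈ 𝓝 0 := Metric.ball_mem_nhds _ (hr.trans hrR)
  have hfg : macl f n - macl g n = iteratedDeriv n (f - g) 0 / n.factorial := by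
    rw [iteratedDeriv_sub (hf.analyticAt h0).contDiffAt (hg.analyticAt h0).contDiffAt, macl, macl,
      sub_div]
  have hd := ((hf.sub hg).diffContOnCl_ball (Metric.closedBall_subset_ball hrR))
  have h1 := Complex.norm_iteratedDeriv_le_of_forall_mem_sphere_norm_le n hr hd
    (fun z hz => h z (le_of_eq (mem_sphere_zero_iff_norm.1 hz)))
  have hn : (0 : ℝ) < n.factorial := by exact_mod_cast n.factorial_pos
  rw [hfg, norm_div, Complex.norm_natCast, div_le_iff₀ hn]
  refine h1.trans (le_of_eq ?_)
  ring

/-- Coefficients of an odd function that is real on the real axis. -/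
theorem macl_of_odd_of_conj {R : ℂ → ℂ} {p : ℕ → ℂ}
    (hsum : ∀ᶠ w in 𝓝 (0 : ℂ), HasSum (fun n => p n * w ^ n) (R w))
    (hodd : ∀ᶠ w in 𝓝 (0 : ℂ), R (-w) = -R w)
    (hconj : ∀ᶠ w in 𝓝 (0 : ℂ), R (conj w) = conj (R w)) (n : ℕ) :
    conj (p n) = p n ∧ (Even n → p n = 0) := by
  have hp := macl_eq_of_hasSum hsum n
  have tneg : Tendsto (fun w : ℂ => -w) (𝓝 0) (𝓝 0) := by
    simpa using (continuous_neg (G := ℂ)).tendsto 0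
  have tconj : Tendsto (fun w : ℂ => conj w) (𝓝 0) (𝓝 0) := by
    simpa using Complex.continuous_conj.tendsto 0
  constructor
  · refine (macl_eq_of_hasSum (f := R) (p := fun n => conj (p n)) ?_ n).symm.trans hp
    filter_upwards [tconj.eventually hsum, hconj] with w h1 h2
    rw [h2] at h1
    refine (Complex.hasSum_conj.2 h1).congr_fun fun k => ?_
    simp
  · intro hn
    have h := macl_eq_of_hasSum (f := R) (p := fun n => -(p n * (-1) ^ n)) (by
      filter_upwards [tneg.eventually hsum, hodd] with w h1 h2
      rw [h2] at h1
      have h3 := h1.neg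
      rw [neg_neg] at h3
      refine h3.congr_fun fun k => ?_
      rw [neg_pow w]
      ring) n
    rw [hp, hn.neg_one_pow, mul_one] at h
    have h2 : (2 : ℂ) * p n = 0 := by linear_combination h
    exact (mul_eq_zero.1 h2).resolve_left two_ne_zero

/-! ### From coefficients of `F` and `F_N` to those of `C`, `S`, `C_N`, `S_N` -/

/-- The scale that relates `C` and `S` to `F`. -/
noncomputable def scale : ℝ := Real.sqrt (Real.pi / 2)

theorem scale_pos : 0 < scale := Real.sqrt_pos.2 (by have := Real.pi_pos; positivity)

theorem scale_sq : scale ^ 2 = Real.pi / 2 := Real.sq_sqrt (by have := Real.pi_pos; positivity)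

/-- The Maclaurin coefficients of `(1 + i) (1/2 - Φ (√(π/2) x))`. -/
noncomputable def scaledCoeff (Φ : ℂ → ℂ) (n : ℕ) : ℂ :=
  (1 + I) * ((if n = 0 then 1 / 2 else 0) - macl Φ n) * (scale : ℂ) ^ n

section Expansion

variable {Φ : ℂ → ℂ} {r : ℝ} {P Q : ℝ → ℝ}

theorem hasSum_half_sub (hΦ : DifferentiableOn ℂ Φ (Metric.ball 0 r)) {z : ℂ} (hz : ‖z‖ < r) :
    HasSum (fun n => ((if n = 0 then 1 / 2 else 0) - macl Φ n) * z ^ n) (1 / 2 - Φ z) := by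
  have h : HasSum (fun n => (if n = 0 then (1 / 2 : ℂ) else 0) * z ^ n) (1 / 2) := by
    have h1 := hasSum_single (f := fun n => (if n = 0 then (1 / 2 : ℂ) else 0) * z ^ n) 0
      (fun n hn => by simp [hn])
    simpa using h1
  refine (h.sub (hasSum_macl hΦ hz)).congr_fun fun n => ?_
  ring

theorem hasSum_scaledCoeff (hΦ : DifferentiableOn ℂ Φ (Metric.ball 0 r))
    (hPQ : ∀ x : ℝ, (P x : ℂ) + Q x * I = (1 + I) * (1 / 2 - Φ (scale * x)))
    {x : ℝ} (hx : scale * |x| < r) :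
    HasSum (fun n => scaledCoeff Φ n * (x : ℂ) ^ n) (P x + Q x * I) := by
  have hz : ‖(scale : ℂ) * x‖ < r := by
    rwa [norm_mul, Complex.norm_real, Complex.norm_real, Real.norm_of_nonneg scale_pos.le]
  rw [hPQ]
  refine ((hasSum_half_sub hΦ hz).mul_left (1 + I)).congr_fun fun n => ?_
  rw [scaledCoeff, mul_pow]
  ring

theorem hasSum_re_scaledCoeff (hΦ : DifferentiableOn ℂ Φ (Metric.ball 0 r))
    (hPQ : ∀ x : ℝ, (P x : ℂ) + Q x * I = (1 + I) * (1 / 2 - Φ (scale * x)))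
    {x : ℝ} (hx : scale * |x| < r) :
    HasSum (fun n => (scaledCoeff Φ n).re * x ^ n) (P x) ∧
      HasSum (fun n => (scaledCoeff Φ n).im * x ^ n) (Q x) := by
  have h := hasSum_scaledCoeff hΦ hPQ hx
  constructor
  · have h1 := Complex.hasSum_re h
    simp only [← ofReal_pow, Complex.re_mul_ofReal] at h1
    simpa using h1
  · have h1 := Complex.hasSum_im h
    simp only [← ofReal_pow, Complex.im_mul_ofReal] at h1
    simpa using h1

theorem eventually_scale_mul_abs_lt (hr : 0 < r) : ∀ᶠ x in 𝓝 (0 : ℝ), scale * |x| < r := by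
  have : Tendsto (fun x : ℝ => scale * |x|) (𝓝 0) (𝓝 (scale * |0|)) :=
    (continuous_abs.const_mul scale).tendsto 0
  rw [abs_zero, mul_zero] at this
  exact this.eventually (gt_mem_nhds hr)

theorem macl_eq_re_scaledCoeff (hr : 0 < r) (hΦ : DifferentiableOn ℂ Φ (Metric.ball 0 r))
    (hPQ : ∀ x : ℝ, (P x : ℂ) + Q x * I = (1 + I) * (1 / 2 - Φ (scale * x))) (n : ℕ) :
    macl P n = (scaledCoeff Φ n).re ∧ macl Q n = (scaledCoeff Φ n).im := by
  constructor
  · refine macl_eq_of_hasSum (p := fun n => (scaledCoeff Φ n).re) ?_ n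
    filter_upwards [eventually_scale_mul_abs_lt hr] with x hx
    exact (hasSum_re_scaledCoeff hΦ hPQ hx).1
  · refine macl_eq_of_hasSum (p := fun n => (scaledCoeff Φ n).im) ?_ n
    filter_upwards [eventually_scale_mul_abs_lt hr] with x hx
    exact (hasSum_re_scaledCoeff hΦ hPQ hx).2

theorem one_add_I_eq : 1 + I = (Real.sqrt 2 : ℂ) * rot := by
  have h0 : ((Real.sqrt 2 : ℝ) : ℂ) ≠ 0 := by
    rw [ofReal_ne_zero]; positivity
  rw [rot_eq]
  field_simp

/-- `Φ - 1/2`, in the variable `w = rot * z` and divided by `i`. -/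
noncomputable def rotated (Φ : ℂ → ℂ) (w : ℂ) : ℂ := -I * (Φ (rot⁻¹ * w) - 1 / 2)

theorem scaledCoeff_structure (hr : 0 < r) (hΦ : DifferentiableOn ℂ Φ (Metric.ball 0 r))
    (hodd : ∀ᶠ w in 𝓝 (0 : ℂ), rotated Φ (-w) = -rotated Φ w)
    (hconj : ∀ᶠ w in 𝓝 (0 : ℂ), rotated Φ (conj w) = conj (rotated Φ w)) (n : ℕ) :
    ((∀ k, n ≠ 4 * k + 1) → (scaledCoeff Φ n).re = 0) ∧
      ((∀ k, n ≠ 4 * k + 3) → (scaledCoeff Φ n).im = 0) := by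
  set p : ℕ → ℂ := fun n => I * ((if n = 0 then 1 / 2 else 0) - macl Φ n) * rot⁻¹ ^ n with hp
  have hsum : ∀ᶠ w in 𝓝 (0 : ℂ), HasSum (fun n => p n * w ^ n) (rotated Φ w) := by
    filter_upwards [Metric.ball_mem_nhds (0 : ℂ) hr] with w hw
    have hz : ‖rot⁻¹ * w‖ < r := by
      rw [norm_mul, norm_inv, norm_rot, inv_one, one_mul]
      exact mem_ball_zero_iff.1 hw
    have h := (hasSum_half_sub hΦ hz).mul_left I
    have e : rotated Φ w = I * (1 / 2 - Φ (rot⁻¹ * w)) := by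
      rw [rotated]
      ring
    rw [e]
    refine h.congr_fun fun k => ?_
    simp only [hp]
    rw [mul_pow]
    ring
  obtain ⟨h1, h2⟩ := macl_of_odd_of_conj hsum hodd hconj n
  obtain ⟨x, hx⟩ := Complex.conj_eq_iff_real.1 h1
  have hrot := rot_ne_zero
  -- With `x` the real `n`-th coefficient of `rotated Φ`, the whole phase is `-i rot^(n+1)`. It
  -- equals `i^m` when `n = 2m + 1`, so the parity of `m` decides between a real and an imaginary
  -- coefficient.
  have hcoef : scaledCoeff Φ n = -((Real.sqrt 2 * scale ^ n * x : ℝ) : ℂ) * (I * rot ^ (n + 1)) := by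
    have e : (if n = 0 then (1 / 2 : ℂ) else 0) - macl Φ n = -I * x * rot ^ n := by
      rw [← hx]
      simp only [hp]
      rw [inv_pow]
      field_simp
      linear_combination ((if n = 0 then (1 / 2 : ℂ) else 0) - macl Φ n) * I_sq
    rw [scaledCoeff, e, one_add_I_eq]
    push_cast
    ring
  rcases Nat.even_or_odd' n with ⟨m, hm | hm⟩
  · have h0 : (x : ℂ) = 0 := by rw [← hx, h2 ⟨m, by omega⟩]
    have hx0 : x = 0 := by exact_mod_cast h0
    rw [hcoef, hx0]
    simp
  · have hpow : rot ^ (n + 1) = I ^ (m + 1) := by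
      rw [hm, ← rot_sq, ← pow_mul]
      congr 1
    have hI : I * I ^ (m + 1) = -I ^ m := by
      rw [pow_succ]
      linear_combination I ^ m * I_sq
    rw [hcoef, hpow, hI, neg_mul_neg, Complex.re_ofReal_mul, Complex.im_ofReal_mul]
    rcases Nat.even_or_odd' m with ⟨k, hk | hk⟩
    · have e : I ^ m = (((-1) ^ k : ℝ) : ℂ) := by
        rw [hk, pow_mul, I_sq]
        push_cast
        rfl
      refine ⟨fun h => absurd (by omega) (h k), fun _ => ?_⟩
      rw [e, Complex.ofReal_im, mul_zero]
    · have e : I ^ m = (((-1) ^ k : ℝ) : ℂ) * I := by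
        rw [hk, pow_succ, pow_mul, I_sq]
        push_cast
        rfl
      refine ⟨fun _ => ?_, fun h => absurd (by omega) (h k)⟩
      rw [e, Complex.re_ofReal_mul, Complex.I_re, mul_zero, mul_zero]

theorem hasSum_macl_mod_four (hr : 0 < r) (hΦ : DifferentiableOn ℂ Φ (Metric.ball 0 r))
    (hodd : ∀ᶠ w in 𝓝 (0 : ℂ), rotated Φ (-w) = -rotated Φ w)
    (hconj : ∀ᶠ w in 𝓝 (0 : ℂ), rotated Φ (conj w) = conj (rotated Φ w))
    (hPQ : ∀ x : ℝ, (P x : ℂ) + Q x * I = (1 + I) * (1 / 2 - Φ (scale * x)))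
    {x : ℝ} (hx : scale * |x| < r) :
    HasSum (fun n => macl P (4 * n + 1) * x ^ (4 * n + 1)) (P x) ∧
      HasSum (fun n => macl Q (4 * n + 3) * x ^ (4 * n + 3)) (Q x) := by
  obtain ⟨h1, h2⟩ := hasSum_re_scaledCoeff hΦ hPQ hx
  simp only [(macl_eq_re_scaledCoeff hr hΦ hPQ _).1, (macl_eq_re_scaledCoeff hr hΦ hPQ _).2]
  constructor
  · have hinj : Function.Injective fun n : ℕ => 4 * n + 1 := fun a b h => by
      have h' : 4 * a + 1 = 4 * b + 1 := h
      omega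
    have h3 := (hinj.hasSum_iff (f := fun n => (scaledCoeff Φ n).re * x ^ n) fun n hn => by
      rw [(scaledCoeff_structure hr hΦ hodd hconj n).1 fun k hk => hn ⟨k, hk.symm⟩,
        zero_mul]).2 h1
    simpa only [Function.comp_def] using h3
  · have hinj : Function.Injective fun n : ℕ => 4 * n + 3 := fun a b h => by
      have h' : 4 * a + 3 = 4 * b + 3 := h
      omega
    have h3 := (hinj.hasSum_iff (f := fun n => (scaledCoeff Φ n).im * x ^ n) fun n hn => by
      rw [(scaledCoeff_structure hr hΦ hodd hconj n).2 fun k hk => hn ⟨k, hk.symm⟩,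
        zero_mul]).2 h2
    simpa only [Function.comp_def] using h3

end Expansion

/-- The factor `scale ^ n` cancels the decay in Cauchy's estimate, leaving `|1 + i| = √2`. -/
theorem norm_scaledCoeff_sub_le {Φ Ψ : ℂ → ℂ} {B : ℝ} {n : ℕ}
    (h : ‖macl Φ n - macl Ψ n‖ ≤ B / scale ^ n) :
    ‖scaledCoeff Φ n - scaledCoeff Ψ n‖ ≤ Real.sqrt 2 * B := by
  have hs := scale_pos
  have e : scaledCoeff Φ n - scaledCoeff Ψ n =
      -((1 + I) * (macl Φ n - macl Ψ n) * (scale : ℂ) ^ n) := by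
    unfold scaledCoeff
    ring
  rw [e, norm_neg, norm_mul, norm_mul, one_add_I_eq, norm_mul, norm_rot, mul_one, norm_pow,
    Complex.norm_real, Complex.norm_real, Real.norm_of_nonneg (Real.sqrt_nonneg _),
    Real.norm_of_nonneg hs.le]
  rw [le_div_iff₀ (by positivity)] at h
  rw [mul_assoc]
  gcongr

/-! ### Symmetries, and the forms on the real axis -/

theorem kernelInt_conj (a : ℝ) (u : ℂ) : kernelInt a (conj u) = conj (kernelInt a u) := by
  unfold kernelInt
  rw [intervalIntegral.integral_of_le zero_le_one, intervalIntegral.integral_of_le zero_le_one,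
    ← integral_conj]
  congr 1
  funext s
  rw [map_mul, ← Complex.exp_conj, map_mul, Complex.conj_ofReal, Complex.conj_ofReal]

theorem rotated_fresnelF (w : ℂ) :
    rotated fresnelF w = w / (2 * Real.sqrt Real.pi) * kernelInt 0 (w ^ 2) := by
  have h : rot * (rot⁻¹ * w) = w := mul_inv_cancel_left₀ rot_ne_zero w
  rw [rotated, fresnelF_eq_kernelInt, h]
  linear_combination -(w / (2 * Real.sqrt Real.pi) * kernelInt 0 (w ^ 2)) * I_sq

theorem rotated_fresnelF_neg (w : ℂ) : rotated fresnelF (-w) = -rotated fresnelF w := by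
  rw [rotated_fresnelF, rotated_fresnelF, neg_sq]
  ring

theorem rotated_fresnelF_conj (w : ℂ) :
    rotated fresnelF (conj w) = conj (rotated fresnelF w) := by
  rw [rotated_fresnelF, rotated_fresnelF, ← map_pow, kernelInt_conj]
  simp only [map_mul, map_div₀, Complex.conj_ofReal, map_ofNat]

theorem fresnelC_add_fresnelS (x : ℝ) :
    (fresnelC x : ℂ) + fresnelS x * I = (1 + I) * (1 / 2 - fresnelF (scale * x)) := by
  have hpi : (Real.sqrt Real.pi : ℂ) ≠ 0 := by
    rw [ofReal_ne_zero]
    exact (Real.sqrt_pos.2 Real.pi_pos).ne'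
  have h2 : (Real.sqrt 2 : ℂ) ≠ 0 := by
    rw [ofReal_ne_zero]; positivity
  have hrot := rot_ne_zero
  have hseg : segInt 0 (scale * x) = scale * (fresnelC x + fresnelS x * I) := by
    have e1 : (fresnelC x : ℂ) + fresnelS x * I =
        ∫ t in (0 : ℝ)..x, cexp (I * ((scale : ℂ) * t) ^ 2) := by
      unfold fresnelC fresnelS
      rw [← intervalIntegral.integral_ofReal, ← intervalIntegral.integral_ofReal,
        ← intervalIntegral.integral_mul_const, ← intervalIntegral.integral_add
        (Continuous.intervalIntegrable (by fun_prop) _ _)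
        (Continuous.intervalIntegrable (by fun_prop) _ _)]
      congr 1
      funext t
      have e : I * ((scale : ℂ) * t) ^ 2 = ((Real.pi / 2 * t ^ 2 : ℝ) : ℂ) * I := by
        rw [← scale_sq]
        push_cast
        ring
      rw [e, Complex.exp_mul_I, ← ofReal_cos, ← ofReal_sin]
    have e2 : ∫ t in (0 : ℝ)..x, cexp (I * ((scale : ℂ) * t) ^ 2) =
        x * ∫ s in (0 : ℝ)..1, cexp (I * ((scale : ℂ) * ((x * s : ℝ) : ℂ)) ^ 2) := by
      rw [← Complex.real_smul,
        intervalIntegral.smul_integral_comp_mul_left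
          (f := fun t : ℝ => cexp (I * ((scale : ℂ) * t) ^ 2))]
      simp
    rw [e1, e2, segInt, sub_zero]
    have e3 : ∀ s : ℝ, cexp (I * (0 + (s : ℂ) * (scale * x)) ^ 2) =
        cexp (I * ((scale : ℂ) * ((x * s : ℝ) : ℂ)) ^ 2) := fun s => by
      congr 1
      push_cast
      ring
    simp_rw [e3]
    ring
  have hscale : (scale : ℂ) = Real.sqrt Real.pi / Real.sqrt 2 := by
    rw [scale, Real.sqrt_div Real.pi_pos.le]
    push_cast
    rfl
  rw [fresnelF_eq, hseg, hscale, one_add_I_eq]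
  field_simp
  ring

theorem cos_add_cosh_pos (θ : ℝ) : 0 < Real.cos θ + Real.cosh θ := by
  rcases eq_or_ne θ 0 with h | h
  · rw [h, Real.cos_zero, Real.cosh_zero]
    norm_num
  · linarith [Real.neg_one_le_cos θ, Real.one_lt_cosh.2 h]

/-- Multiply numerator and denominator by the cosine of the conjugate argument and use
product-to-sum formulas. The denominator `cos θ + cosh θ` is positive, so there is no pole. -/
theorem tan_half_mul_one_add_I (θ : ℝ) :
    Complex.cos (θ / 2 * (1 + I)) ≠ 0 ∧
    Complex.tan (θ / 2 * (1 + I)) =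
      (Real.sin θ + Real.sinh θ * I) / ((Real.cos θ + Real.cosh θ : ℝ) : ℂ) := by
  set y : ℂ := θ / 2 * (1 + I) with hy
  set y' : ℂ := θ / 2 * (1 - I) with hy'
  have h1 : y + y' = θ := by rw [hy, hy']; ring
  have h2 : y - y' = θ * I := by rw [hy, hy']; ring
  have hs : 2 * (Complex.sin y * Complex.cos y') = Real.sin θ + Real.sinh θ * I := by
    have e1 := Complex.sin_add y y'
    have e2 := Complex.sin_sub y y'
    rw [h1] at e1
    rw [h2, Complex.sin_mul_I] at e2
    push_cast
    linear_combination -e1 - e2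
  have hc : 2 * (Complex.cos y * Complex.cos y') = ((Real.cos θ + Real.cosh θ : ℝ) : ℂ) := by
    have e1 := Complex.cos_add y y'
    have e2 := Complex.cos_sub y y'
    rw [h1] at e1
    rw [h2, Complex.cos_mul_I] at e2
    push_cast
    linear_combination -e1 - e2
  have hne : ((Real.cos θ + Real.cosh θ : ℝ) : ℂ) ≠ 0 := by
    rw [ofReal_ne_zero]
    exact (cos_add_cosh_pos θ).ne'
  rw [← hc] at hne
  have hprod := right_ne_zero_of_mul hne
  have c1 := left_ne_zero_of_mul hprod
  have c2 := right_ne_zero_of_mul hprod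
  refine ⟨c1, ?_⟩
  rw [← hs, ← hc, Complex.tan_eq_sin_div_cos]
  field_simp

theorem continuousAt_FNformula {N : ℕ} {z : ℂ} (hc : Complex.cos (A N * (rot * z)) ≠ 0)
    (ht : ∀ j ∈ Finset.range N, (tau N j : ℂ) ^ 2 - (rot * z) ^ 2 ≠ 0) :
    ContinuousAt (FNformula N) z := by
  have e : FNformula N = fun z => 1 / 2 + I / 2 * Complex.tan (A N * (rot * z)) -
      I * (rot * z) / A N * cexp ((rot * z) ^ 2) *
        ∑ j ∈ Finset.range N, cexp (-(tau N j : ℂ) ^ 2) / ((tau N j : ℂ) ^ 2 - (rot * z) ^ 2) :=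
    funext (FNformula_eq N)
  rw [e]
  have h1 : ContinuousAt (fun z : ℂ => Complex.tan (A N * (rot * z))) z :=
    ContinuousAt.comp (f := fun z : ℂ => (A N : ℂ) * (rot * z)) (g := Complex.tan)
      (Complex.continuousAt_tan.2 hc) (by fun_prop)
  have h2 : ContinuousAt (fun z : ℂ => I * (rot * z) / A N * cexp ((rot * z) ^ 2)) z := by fun_prop
  have h3 : ContinuousAt (fun z : ℂ => ∑ j ∈ Finset.range N, cexp (-(tau N j : ℂ) ^ 2) /
      ((tau N j : ℂ) ^ 2 - (rot * z) ^ 2)) z :=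
    tendsto_finsetSum _ fun j hj => ContinuousAt.div continuousAt_const (by fun_prop) (ht j hj)
  exact (continuousAt_const.add (h1.const_mul _)).sub (h2.mul h3)

theorem rotated_FNformula (N : ℕ) (w : ℂ) :
    rotated (FNformula N) w = 1 / 2 * Complex.tan (A N * w) - w / A N * cexp (w ^ 2) *
      ∑ j ∈ Finset.range N, cexp (-(tau N j : ℂ) ^ 2) / ((tau N j : ℂ) ^ 2 - w ^ 2) := by
  have h : rot * (rot⁻¹ * w) = w := mul_inv_cancel_left₀ rot_ne_zero w
  rw [rotated, FNformula_eq, h]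
  linear_combination (-(1 / 2 * Complex.tan (A N * w)) + w / A N * cexp (w ^ 2) *
      ∑ j ∈ Finset.range N, cexp (-(tau N j : ℂ) ^ 2) / ((tau N j : ℂ) ^ 2 - w ^ 2)) * I_sq

theorem eventually_rotated_FN (N : ℕ) :
    ∀ᶠ w in 𝓝 (0 : ℂ), rotated (FN N) w = rotated (FNformula N) w := by
  have hc : ∀ᶠ w in 𝓝 (0 : ℂ), Complex.cos (A N * w) ≠ 0 := by
    refine ContinuousAt.eventually_ne (g := fun w : ℂ => Complex.cos (A N * w)) (by fun_prop) ?_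
    simp
  have ht : ∀ᶠ w in 𝓝 (0 : ℂ), ∀ j ∈ Finset.range N, (tau N j : ℂ) ^ 2 - w ^ 2 ≠ 0 := by
    rw [Filter.eventually_all_finset]
    intro j _
    refine ContinuousAt.eventually_ne (g := fun w : ℂ => (tau N j : ℂ) ^ 2 - w ^ 2)
      (by fun_prop) ?_
    have : (tau N j : ℂ) ≠ 0 := by exact_mod_cast (tau_pos N j).ne'
    simpa using this
  filter_upwards [hc, ht] with w h1 h2
  have h : rot * (rot⁻¹ * w) = w := mul_inv_cancel_left₀ rot_ne_zero w
  rw [rotated, rotated, FN_eq_FNformula (continuousAt_FNformula (by rwa [h]) (by rwa [h]))]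

theorem rotated_FNformula_neg (N : ℕ) (w : ℂ) :
    rotated (FNformula N) (-w) = -rotated (FNformula N) w := by
  rw [rotated_FNformula, rotated_FNformula, mul_neg, Complex.tan_neg, neg_sq]
  ring

theorem rotated_FNformula_conj (N : ℕ) (w : ℂ) :
    rotated (FNformula N) (conj w) = conj (rotated (FNformula N) w) := by
  have h1 : (A N : ℂ) * conj w = conj (A N * w) := by rw [map_mul, Complex.conj_ofReal]
  have h2 (t : ℝ) : conj (cexp (-(t : ℂ) ^ 2)) = cexp (-(t : ℂ) ^ 2) := by
    rw [← Complex.exp_conj, map_neg, map_pow, Complex.conj_ofReal]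
  rw [rotated_FNformula, rotated_FNformula, h1, Complex.tan_conj, ← map_pow, Complex.exp_conj]
  simp only [map_sub, map_mul, map_div₀, map_sum, Complex.conj_ofReal, map_pow, h2, map_one,
    map_ofNat]

theorem eventually_rotated_FN_neg (N : ℕ) :
    ∀ᶠ w in 𝓝 (0 : ℂ), rotated (FN N) (-w) = -rotated (FN N) w := by
  have t : Tendsto (fun w : ℂ => -w) (𝓝 0) (𝓝 0) := by
    simpa using (continuous_neg (G := ℂ)).tendsto 0
  filter_upwards [eventually_rotated_FN N, t.eventually (eventually_rotated_FN N)] with w h1 h2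
  rw [h1, h2, rotated_FNformula_neg]

theorem eventually_rotated_FN_conj (N : ℕ) :
    ∀ᶠ w in 𝓝 (0 : ℂ), rotated (FN N) (conj w) = conj (rotated (FN N) w) := by
  have t : Tendsto (fun w : ℂ => conj w) (𝓝 0) (𝓝 0) := by
    simpa using Complex.continuous_conj.tendsto 0
  filter_upwards [eventually_rotated_FN N, t.eventually (eventually_rotated_FN N)] with w h1 h2
  rw [h1, h2, rotated_FNformula_conj]

theorem scale_mul_rot : (scale : ℂ) * rot = Real.sqrt Real.pi / 2 * (1 + I) := by
  have h2 : (Real.sqrt 2 : ℂ) ≠ 0 := by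
    rw [ofReal_ne_zero]; positivity
  have h22 : (Real.sqrt 2 : ℂ) ^ 2 = 2 := by
    rw [← ofReal_pow, Real.sq_sqrt (by norm_num)]; simp
  have hscale : (scale : ℂ) = Real.sqrt Real.pi / Real.sqrt 2 := by
    rw [scale, Real.sqrt_div Real.pi_pos.le]
    push_cast
    rfl
  rw [hscale, rot_eq]
  field_simp
  rw [h22]
  ring

theorem A_mul_rot_mul_scale (N : ℕ) (x : ℝ) : (A N : ℂ) * (rot * (scale * x)) =
    ((Real.sqrt Real.pi * A N * x : ℝ) : ℂ) / 2 * (1 + I) := by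
  push_cast
  linear_combination (A N : ℂ) * x * scale_mul_rot

/-- For real `z` the number `w²` is purely imaginary, so it never equals a `τ²`, and the cosine does
not vanish: the formula is regular there. -/
theorem FN_scale_mul_ofReal (N : ℕ) (x : ℝ) : FN N (scale * x) = FNformula N (scale * x) := by
  refine FN_eq_FNformula (continuousAt_FNformula ?_ fun j _ h => ?_)
  · rw [A_mul_rot_mul_scale]
    exact (tan_half_mul_one_add_I _).1
  · have e : (rot * (scale * x)) ^ 2 = (((scale * x) ^ 2 : ℝ) : ℂ) * I := by
      rw [mul_pow, rot_sq]
      push_cast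
      ring
    rw [e, ← ofReal_pow] at h
    have h1 := congrArg Complex.re h
    simp only [Complex.sub_re, Complex.ofReal_re, Complex.re_ofReal_mul, Complex.I_re, mul_zero,
      sub_zero, Complex.zero_re] at h1
    exact (pow_pos (tau_pos N j) 2).ne' h1

theorem sum_nodes_eq (N : ℕ) (s : ℝ) :
    ∑ k ∈ Finset.Icc 1 N, cexp (-(node N k : ℂ) ^ 2) / ((s : ℂ) + I * (node N k : ℂ) ^ 2) =
      aN N s - bN N s * I := by
  unfold aN bN
  push_cast
  rw [Finset.mul_sum, Finset.sum_mul, ← Finset.sum_sub_distrib]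
  refine Finset.sum_congr rfl fun k hk => ?_
  obtain ⟨j, rfl⟩ : ∃ j, k = j + 1 := ⟨k - 1, by have := (Finset.mem_Icc.1 hk).1; omega⟩
  rw [node_succ]
  have ht := tau_pos N j
  set t := tau N j
  have h1 : (s : ℂ) ^ 2 + (t : ℂ) ^ 4 ≠ 0 := by
    have : s ^ 2 + t ^ 4 ≠ 0 := by positivity
    exact_mod_cast this
  have h2 : ((s : ℂ) + I * (t : ℂ) ^ 2) * (s - I * (t : ℂ) ^ 2) = (s : ℂ) ^ 2 + (t : ℂ) ^ 4 := by
    linear_combination -(t : ℂ) ^ 4 * I_sq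
  have h3 : (s : ℂ) + I * (t : ℂ) ^ 2 ≠ 0 := fun h => h1 (by rw [← h2, h, zero_mul])
  rw [div_eq_iff h3]
  field_simp
  linear_combination -h2

theorem CN_add_SN (N : ℕ) (x : ℝ) :
    (CN N x : ℂ) + SN N x * I = (1 + I) * (1 / 2 - FN N (scale * x)) := by
  have hz : ((scale : ℂ) * x) ^ 2 = ((Real.pi / 2 * x ^ 2 : ℝ) : ℂ) := by
    rw [← scale_sq]
    push_cast
    ring
  set s : ℝ := Real.pi / 2 * x ^ 2 with hs
  set θ : ℝ := Real.sqrt Real.pi * A N * x with hθ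
  have htan : Complex.tan ((A N : ℂ) * (scale * x) * cexp (I * (Real.pi / 4))) =
      (Real.sin θ + Real.sinh θ * I) / ((Real.cos θ + Real.cosh θ : ℝ) : ℂ) := by
    rw [← (tan_half_mul_one_add_I θ).2, ← A_mul_rot_mul_scale]
    congr 1
    change _ * rot = _
    ring
  have hexp : cexp (I * ((s : ℂ) + Real.pi / 4)) =
      rot * ((Real.cos s : ℂ) + Real.sin s * I) := by
    rw [mul_add, Complex.exp_add, mul_comm I (s : ℂ), Complex.exp_mul_I, ← ofReal_cos,
      ← ofReal_sin]
    change _ * rot = _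
    ring
  have hfac : (1 + I) * ((scale : ℂ) * x / A N * rot) = Real.sqrt Real.pi * x / A N * I := by
    linear_combination (1 + I) * x / A N * scale_mul_rot +
      Real.sqrt Real.pi * x / (2 * A N) * I_sq
  have hFN : (1 + I) * (1 / 2 - FN N (scale * x)) =
      -(1 + I) * I / 2 * ((Real.sin θ + Real.sinh θ * I) / ((Real.cos θ + Real.cosh θ : ℝ) : ℂ))
      - Real.sqrt Real.pi * x / A N * I * ((Real.cos s : ℂ) + Real.sin s * I) *
        (aN N s - bN N s * I) := by
    rw [FN_scale_mul_ofReal, FNformula, htan, hz, hexp, sum_nodes_eq]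
    linear_combination -((Real.cos s : ℂ) + Real.sin s * I) * (aN N s - bN N s * I) * hfac
  rw [hFN, CN, SN, ← hs, ← hθ]
  push_cast
  linear_combination (1 / 2 * ((Complex.sin θ + Complex.sinh θ + I * Complex.sinh θ) /
      (Complex.cos θ + Complex.cosh θ)) +
    Real.sqrt Real.pi * x / A N * (aN N s * Complex.sin s - bN N s * Complex.cos s -
      bN N s * Complex.sin s * I)) * I_sq

/-- Since `Re w² ≤ |z|² < A²`, the truncation error is analytic on this ball, where `FN` is a
difference of analytic functions. -/
theorem differentiableOn_FN (N : ℕ) : DifferentiableOn ℂ (FN N) (Metric.ball 0 (A N)) := by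
  intro z hz
  have hopen : IsOpen {z : ℂ | ((rot * z) ^ 2).re < A N ^ 2} :=
    isOpen_lt (Complex.continuous_re.comp (by fun_prop)) continuous_const
  have hmem : ((rot * z) ^ 2).re < A N ^ 2 := by
    refine (Complex.re_le_norm _).trans_lt ?_
    rw [norm_pow, norm_rot_mul]
    have := mem_ball_zero_iff.1 hz
    gcongr
  have hr : DifferentiableAt ℂ (fun z : ℂ => rot * z) z := by fun_prop
  have hd : DifferentiableAt ℂ
      (fun z => fresnelF z - quadError N (rot * z) - truncError N (rot * z)) z :=
    ((differentiable_fresnelF z).sub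
      (DifferentiableAt.comp z (differentiable_quadError N (rot * z)) hr)).sub
      (DifferentiableAt.comp z (differentiableAt_truncError_of_re hmem) hr)
  refine (hd.congr_of_eventuallyEq ?_).differentiableWithinAt
  filter_upwards [hopen.mem_nhds hmem] with z' hz'
  exact FN_eq_sub (differentiableAt_truncError_of_re hz')

theorem scale_mul_abs_lt {N : ℕ} {x : ℝ} (hx : |x| < A N / Real.sqrt Real.pi) :
    scale * |x| < A N := by
  have hs : 0 < Real.sqrt Real.pi := Real.sqrt_pos.2 Real.pi_pos
  have h2 : 1 ≤ Real.sqrt 2 := by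
    rw [Real.one_le_sqrt]
    norm_num
  rw [lt_div_iff₀ hs] at hx
  refine lt_of_le_of_lt ?_ hx
  rw [scale, Real.sqrt_div Real.pi_pos.le, mul_comm]
  gcongr
  exact div_le_self hs.le h2

end FresnelTrap

theorem mainTheorem9 (N : ℕ) (hN : 1 ≤ N) :
    -- the error bound in the closed first and third quadrants
    (∀ z : ℂ, 0 ≤ z.re * z.im →
      ‖FresnelTrap.fresnelF z - FresnelTrap.FN N z‖ ≤
        FresnelTrap.c N * (Real.exp (-(Real.pi * N)) / Real.sqrt ((N : ℝ) + 1 / 2))) ∧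
    -- the error bound in part of the closed second and fourth quadrants
    (∀ z : ℂ, z.re * z.im ≤ 0 → |z.im| ≤ FresnelTrap.A N / (2 * Real.sqrt 2) →
      ‖FresnelTrap.fresnelF z - FresnelTrap.FN N z‖ ≤
        FresnelTrap.cHat N * Real.exp (-(2 * (z.re * z.im))) *
          (Real.exp (-(Real.pi * N)) / Real.sqrt ((N : ℝ) + 1 / 2))) ∧
    -- the Maclaurin expansions of `F` and `F_N`
    (∀ z : ℂ, ‖z‖ < FresnelTrap.A N / Real.sqrt 2 →
      HasSum (fun n : ℕ => FresnelTrap.macl FresnelTrap.fresnelF n * z ^ n)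
        (FresnelTrap.fresnelF z) ∧
      HasSum (fun n : ℕ => FresnelTrap.macl (FresnelTrap.FN N) n * z ^ n)
        (FresnelTrap.FN N z)) ∧
    -- the Maclaurin expansions of `C`, `S`, `C_N` and `S_N`
    (∀ x : ℝ, |x| < FresnelTrap.A N / Real.sqrt Real.pi →
      HasSum (fun n : ℕ => FresnelTrap.macl FresnelTrap.fresnelC (4 * n + 1) * x ^ (4 * n + 1))
        (FresnelTrap.fresnelC x) ∧
      HasSum (fun n : ℕ => FresnelTrap.macl FresnelTrap.fresnelS (4 * n + 3) * x ^ (4 * n + 3))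
        (FresnelTrap.fresnelS x) ∧
      HasSum (fun n : ℕ => FresnelTrap.macl (FresnelTrap.CN N) (4 * n + 1) * x ^ (4 * n + 1))
        (FresnelTrap.CN N x) ∧
      HasSum (fun n : ℕ => FresnelTrap.macl (FresnelTrap.SN N) (4 * n + 3) * x ^ (4 * n + 3))
        (FresnelTrap.SN N x)) ∧
    (4 ≤ N →
      -- the error bound on the disc of radius `√(π/2)`
      (∀ z : ℂ, ‖z‖ < Real.sqrt (Real.pi / 2) →
        ‖FresnelTrap.fresnelF z - FresnelTrap.FN N z‖ ≤
          FresnelTrap.cHat N *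
            (Real.exp (-(Real.pi * ((N : ℝ) - 1 / 4))) / Real.sqrt ((N : ℝ) + 1 / 2))) ∧
      -- the difference of the Maclaurin coefficients of `F` and `F_N`
      (∀ n : ℕ,
        ‖FresnelTrap.macl FresnelTrap.fresnelF n - FresnelTrap.macl (FresnelTrap.FN N) n‖ ≤
          FresnelTrap.cHat N * (2 / Real.pi) ^ ((n : ℝ) / 2) *
            (Real.exp (-(Real.pi * ((N : ℝ) - 1 / 4))) / Real.sqrt ((N : ℝ) + 1 / 2))) ∧
      -- the differences of the Maclaurin coefficients of `C` and `C_N`, and of `S` and `S_N`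
      (∀ n : ℕ,
        |FresnelTrap.macl FresnelTrap.fresnelC n - FresnelTrap.macl (FresnelTrap.CN N) n| ≤
          Real.sqrt 2 * FresnelTrap.cHat N *
            (Real.exp (-(Real.pi * ((N : ℝ) - 1 / 4))) / Real.sqrt ((N : ℝ) + 1 / 2)) ∧
        |FresnelTrap.macl FresnelTrap.fresnelS n - FresnelTrap.macl (FresnelTrap.SN N) n| ≤
          Real.sqrt 2 * FresnelTrap.cHat N *
            (Real.exp (-(Real.pi * ((N : ℝ) - 1 / 4))) / Real.sqrt ((N : ℝ) + 1 / 2)))) := by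
  open FresnelTrap in
  have hA := A_pos N
  have hF : DifferentiableOn ℂ fresnelF (Metric.ball 0 (A N)) :=
    differentiable_fresnelF.differentiableOn
  have hFN := differentiableOn_FN N
  refine ⟨fun z hz => norm_fresnelF_sub_FN_le_of_nonneg N hz,
    fun z hz hy => norm_fresnelF_sub_FN_le_of_nonpos N hz hy, fun z hz => ?_, fun x hx => ?_,
    fun hN4 => ?_⟩
  · have hz' : ‖z‖ < A N := hz.trans_le (div_le_self hA.le (by
      rw [Real.one_le_sqrt]
      norm_num))
    exact ⟨hasSum_macl hF hz', hasSum_macl hFN hz'⟩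
  · have hx' := scale_mul_abs_lt hx
    have h1 := hasSum_macl_mod_four hA hF (Eventually.of_forall rotated_fresnelF_neg)
      (Eventually.of_forall rotated_fresnelF_conj) fresnelC_add_fresnelS hx'
    have h2 := hasSum_macl_mod_four hA hFN (eventually_rotated_FN_neg N)
      (eventually_rotated_FN_conj N) (CN_add_SN N) hx'
    exact ⟨h1.1, h1.2, h2.1, h2.2⟩
  · have hlt : scale < A N := by
      have h3 : 3 * scale ≤ A N := three_mul_le_A hN4
      linarith [scale_pos]
    -- Cauchy's estimate is taken on the circle of radius `√(π/2)` itself, so it needs the disc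
    -- bound up to the boundary.
    have hcoef := norm_macl_sub_le scale_pos hlt hF hFN
      (fun z hz => norm_fresnelF_sub_FN_le_of_norm hN4 hz)
    refine ⟨fun z hz => norm_fresnelF_sub_FN_le_of_norm hN4 hz.le, fun n => ?_, fun n => ?_⟩
    · refine (hcoef n).trans (le_of_eq ?_)
      have hpi := Real.pi_pos
      have e : (2 / Real.pi) ^ ((n : ℝ) / 2) = (scale ^ n)⁻¹ := by
        rw [← inv_pow, ← Real.rpow_natCast, scale, ← Real.sqrt_inv, inv_div, Real.sqrt_eq_rpow,
          ← Real.rpow_mul (by positivity)]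
        congr 1
        ring
      rw [e]
      ring
    · have h := norm_scaledCoeff_sub_le (hcoef n)
      rw [← mul_assoc] at h
      rw [(macl_eq_re_scaledCoeff hA hF fresnelC_add_fresnelS n).1,
        (macl_eq_re_scaledCoeff hA hF fresnelC_add_fresnelS n).2,
        (macl_eq_re_scaledCoeff hA hFN (CN_add_SN N) n).1,
        (macl_eq_re_scaledCoeff hA hFN (CN_add_SN N) n).2, ← Complex.sub_re, ← Complex.sub_im]
      exact ⟨(Complex.abs_re_le_norm _).trans h, (Complex.abs_im_le_norm _).trans h⟩
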